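/- Throughout, $2^\omega$ is Cantor space, $\langle p,q\rangle$ is the effective join of $p,q\in 2^\omega$ (with $\langle p,q\rangle(2n)=p(n)$ and $\langle p,q\rangle(2n+1)=q(n)$), and $\langle i,p\rangle=\langle\{i\},p\rangle$ for $i<2$, where sets of natural numbers are identified with their characteristic functions. A partial multifunction $f:\subseteq 2^\omega\rightrightarrows 2^\omega$ assigns to every $p$ a set $f(p)\subseteq 2^\omega$, with $\operatorname{dom}(f)=\{p: f(p)\neq\emptyset\}$. A partial function $F:\subseteq 2^\omega\to 2^\omega$ is a realizer of $f$, written $F\vdash f$, if $F(p)$ is defined and $F(p)\in f(p)$ for all $p\in\operatorname{dom}(f)$. One writes $f\le_{\mathrm{sW}} g$ ($f$ is strongly Weihrauch reducible to $g$) if there are Turing functionals $\Phi,\Psi:\subseteq 2^\omega\to 2^\omega$ such that $\Psi\circ G\circ\Phi\vdash f$ for all $G\vdash g$. The strong Weihrauch degrees are the equivalence classes of partial multifunctions on $2^\omega$ under $\le_{\mathrm{sW}}\cap\ge_{\mathrm{sW}}$, ordered by $\le_{\mathrm{sW}}$. A total monotone approximation is a set $a\subseteq\omega$ all of whose elements are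 of the form $\langle n,s,i\rangle$ with $i<2$, which contains exactly one such triple for every $n$, and for which $\langle m,s,i\rangle,\langle n,t,j\rangle\in a$ and $m<n$ imply $s<t$. For such $a$ let $\mathrm e(a)\in 2^\omega$ be given by $\mathrm e(a)(n)=i$ iff $\langle n,s,i\rangle\in a$ for some $s$; for other $a$ let $\mathrm e(a)$ be undefined. The strong Weihrauch degrees form a lattice, the strong Weihrauch lattice, in which the join of the degrees of $f$ and $g$ is the degree of $f\boxplus g$ and their meet is the degree of $f\sqcap g$, where $$(f\boxplus g)(\langle 0,p\rangle)=\{\langle a,b\rangle: \mathrm e(a)\text{ is defined and } \mathrm e(a)\in f(p)\},\qquad (f\boxplus g)(\langle 1,p\rangle)=\{\langle a,b\rangle: \mathrm e(b)\text{ is defined and } \mathrm e(b)\in g(p)\},$$ $$(f\sqcap g)(\langle p_0,p_1\rangle)=\{\langle 0,q\rangle: q\in f(p_0)\}\cup\{\langle 1,q\rangle: q\in g(p_1)\}\qquad\text{for } p_0\in\operatorname{dom}(f),\ p_1\in\operatorname{dom}(g),$$ and both are undefined at all other points. **Corollary.** Every countable distributive lattice embeds into the strong Weihrauch lattice: for every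 countable distributive lattice $L$ there is an injective map from $L$ to the strong Weihrauch degrees that preserves binary joins and binary meets. -/

import Mathlib

/-! ## Cantor space and Turing functionals -/

/-- Cantor space `2^ω`; a point is identified with the subset of `ℕ` on which it is `true`. -/
abbrev Cantor : Type := ℕ → Bool

/-- The partial recursive functionals `T^p(n)` of a number `n` and an oracle `p ∈ 2^ω`: the least
class that contains zero, successor, the projections of the pairing function and the oracle, and is
closed under pairing, composition, primitive recursion and minimization, uniformly in `p`. -/
inductive OracleRec : (Cantor → ℕ →. ℕ) → Prop
  | zero : OracleRec fun _ _ => Part.some 0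
  | succ : OracleRec fun _ n => Part.some (n + 1)
  | left : OracleRec fun _ n => Part.some (Nat.unpair n).1
  | right : OracleRec fun _ n => Part.some (Nat.unpair n).2
  | oracle : OracleRec fun p n => Part.some (p n).toNat
  | pair {f h : Cantor → ℕ →. ℕ} : OracleRec f → OracleRec h →
      OracleRec fun p n => (f p n).bind fun a => (h p n).map fun b => Nat.pair a b
  | comp {f h : Cantor → ℕ →. ℕ} : OracleRec f → OracleRec h →
      OracleRec fun p n => (h p n).bind fun a => f p a
  | prec {f h : Cantor → ℕ →. ℕ} : OracleRec f → OracleRec h →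
      OracleRec fun p m =>
        Nat.rec (f p (Nat.unpair m).1)
          (fun y IH => IH.bind fun i => h p (Nat.pair (Nat.unpair m).1 (Nat.pair y i)))
          (Nat.unpair m).2
  | rfind {f : Cantor → ℕ →. ℕ} : OracleRec f →
      OracleRec fun p a => Nat.rfind fun n => (f p (Nat.pair a n)).map fun m => decide (m = 0)

/-- `F :⊆ 2^ω → 2^ω` is a Turing functional: some oracle program `T` computes it, where `F(p)` is
defined, with value `q`, precisely if `T^p` is total with values `q(n) ∈ {0,1}`. -/
def IsTuringFunctional (F : Cantor →. Cantor) : Prop :=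
  ∃ T, OracleRec T ∧ ∀ p q, q ∈ F p ↔ ∀ n, (q n).toNat ∈ T p n

/-! ## Problems and strong Weihrauch reducibility -/

/-- A partial multifunction `f :⊆ 2^ω ⇉ 2^ω`, given by its sets of values; `f` is undefined
at `p` if `f(p)` is empty. -/
@[ext]
structure Problem : Type where
  /-- The set `f(p)` of solutions of the instance `p`. -/
  sol : Cantor → Set Cantor

namespace Problem

/-- The domain of a partial multifunction. -/
def dom (f : Problem) : Set Cantor := {p | (f.sol p).Nonempty}

/-- The partial function `F` is a realizer of `f`. -/
def Realizes (F : Cantor →. Cantor) (f : Problem) : Prop :=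
  ∀ p ∈ f.dom, ∃ q ∈ F p, q ∈ f.sol p

/-- Strong Weihrauch reducibility `f ≤_sW g`: there are Turing functionals `Φ`, `Ψ` such that
`Ψ ∘ G ∘ Φ` realizes `f` whenever `G` realizes `g`. -/
def SWReducible (f g : Problem) : Prop :=
  ∃ Φ Ψ : Cantor →. Cantor, IsTuringFunctional Φ ∧ IsTuringFunctional Ψ ∧
    ∀ G : Cantor →. Cantor, Realizes G g → Realizes (Ψ.comp (G.comp Φ)) f

end Problem

/-! ## The lattice operations on problems -/

/-- The effective join `⟨p, q⟩` of two points of Cantor space. -/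
def cjoin (p q : Cantor) : Cantor := fun n => if n % 2 = 0 then p (n / 2) else q (n / 2)

/-- The singleton `{i}` as a point of Cantor space, so that `cjoin (tag i) p` is `⟨i, p⟩`. -/
def tag (i : ℕ) : Cantor := fun n => decide (n = i)

/-- The triple `⟨n, s, i⟩`. -/
def triple (n s i : ℕ) : ℕ := Nat.pair n (Nat.pair s i)

/-- Monotone approximations. -/
structure IsMonotoneApprox (a : Cantor) : Prop where
  form : ∀ m, a m = true → ∃ n s i, i < 2 ∧ m = triple n s i
  unique : ∀ n s t i j, i < 2 → j < 2 → a (triple n s i) = true → a (triple n t j) = true →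
    s = t ∧ i = j
  mono : ∀ m n s t i j, i < 2 → j < 2 → a (triple m s i) = true → a (triple n t j) = true →
    m < n → s < t

/-- A total monotone approximation. -/
def IsTotalMonotoneApprox (a : Cantor) : Prop :=
  IsMonotoneApprox a ∧ ∀ n, ∃ s i, i < 2 ∧ a (triple n s i) = true

open Classical in
/-- The evaluation map `e`, whose domain consists of the total monotone approximations:
`e(a)(n) = i` if and only if `⟨n, s, i⟩ ∈ a` for some `s`. -/
noncomputable def approxEval : Cantor →. Cantor := fun a =>
  ⟨IsTotalMonotoneApprox a, fun _ n => decide (∃ s, a (triple n s 1) = true)⟩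

namespace Problem

/-- The join operation `f ⊞ g`. An instance is `⟨0, p⟩` with `p ∈ dom f` or `⟨1, p⟩` with
`p ∈ dom g`. A point `⟨a, b⟩` names the pair `(e(a), e(b))`, where a component is read as the
additional point `∞` if `e` is undefined there; it solves `⟨0, p⟩` if `e(a)` is defined and
belongs to `f(p)`, and it solves `⟨1, p⟩` if `e(b)` is defined and belongs to `g(p)`. -/
def boxplus (f g : Problem) : Problem where
  sol r := {w | ∃ a b, w = cjoin a b ∧
    ((∃ p, r = cjoin (tag 0) p ∧ ∃ y ∈ approxEval a, y ∈ f.sol p) ∨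
     (∃ p, r = cjoin (tag 1) p ∧ ∃ y ∈ approxEval b, y ∈ g.sol p))}

/-- The meet operation `f ⊓ g`: an instance is `⟨p₀, p₁⟩` with `p₀ ∈ dom f` and `p₁ ∈ dom g`, and
its solutions are `⟨0, q⟩` for `q ∈ f(p₀)` and `⟨1, q⟩` for `q ∈ g(p₁)`. -/
def meet (f g : Problem) : Problem where
  sol r := {w | ∃ p₀ ∈ f.dom, ∃ p₁ ∈ g.dom, r = cjoin p₀ p₁ ∧
    ((∃ q ∈ f.sol p₀, w = cjoin (tag 0) q) ∨ (∃ q ∈ g.sol p₁, w = cjoin (tag 1) q))}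

end Problem

/-! ## Closure properties of the partial recursive functionals -/

/-- Total oracle-recursive functions. -/
def TotalRec (F : Cantor → ℕ → ℕ) : Prop := OracleRec fun p n => Part.some (F p n)

theorem OracleRec.of_eq {S T : Cantor → ℕ →. ℕ} (hS : OracleRec S) (h : ∀ p n, S p n = T p n) :
    OracleRec T := by
  have : S = T := by funext p n; exact h p n
  exact this ▸ hS

theorem OracleRec.of_partrec {f : ℕ →. ℕ} (hf : Nat.Partrec f) : OracleRec fun _ => f := by
  induction hf with
  | zero => exact OracleRec.zero
  | succ => exact OracleRec.succ
  | left => exact OracleRec.left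
  | right => exact OracleRec.right
  | pair _ _ h1 h2 =>
    refine (OracleRec.pair h1 h2).of_eq fun p n => ?_
    simp [Seq.seq, Part.bind_map]
  | comp _ _ h1 h2 => exact OracleRec.comp h1 h2
  | prec _ _ h1 h2 => exact OracleRec.prec h1 h2
  | rfind _ h => exact OracleRec.rfind h

namespace TotalRec

theorem of_eq {F G : Cantor → ℕ → ℕ} (hF : TotalRec F) (h : ∀ p n, F p n = G p n) :
    TotalRec G := by
  have : F = G := by funext p n; exact h p n
  exact this ▸ hF

theorem of_computable {f : ℕ → ℕ} (hf : Computable f) : TotalRec fun _ n => f n :=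
  OracleRec.of_partrec (Partrec.nat_iff.1 hf.partrec)

theorem oracle : TotalRec fun p n => (p n).toNat := OracleRec.oracle

theorem comp {F G : Cantor → ℕ → ℕ} (hF : TotalRec F) (hG : TotalRec G) :
    TotalRec fun p n => F p (G p n) :=
  (OracleRec.comp hF hG).of_eq fun p n => by simp

theorem pair {F G : Cantor → ℕ → ℕ} (hF : TotalRec F) (hG : TotalRec G) :
    TotalRec fun p n => Nat.pair (F p n) (G p n) :=
  (OracleRec.pair hF hG).of_eq fun p n => by simp

theorem comp₂ {f : ℕ → ℕ → ℕ} (hf : Computable₂ f) {F G : Cantor → ℕ → ℕ} (hF : TotalRec F)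
    (hG : TotalRec G) : TotalRec fun p n => f (F p n) (G p n) := by
  have h : Computable fun m : ℕ => f m.unpair.1 m.unpair.2 :=
    hf.comp (Computable.fst.comp Computable.unpair) (Computable.snd.comp Computable.unpair)
  exact ((of_computable h).comp (hF.pair hG)).of_eq fun p n => by simp

theorem id : TotalRec fun _ n => n := of_computable Computable.id

theorem const (c : ℕ) : TotalRec fun _ _ => c := of_computable (Computable.const c)

theorem fst {F : Cantor → ℕ → ℕ} (hF : TotalRec F) : TotalRec fun p n => (F p n).unpair.1 :=
  comp (of_computable (Computable.fst.comp Computable.unpair)) hF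

theorem snd {F : Cantor → ℕ → ℕ} (hF : TotalRec F) : TotalRec fun p n => (F p n).unpair.2 :=
  comp (of_computable (Computable.snd.comp Computable.unpair)) hF

theorem succ {F : Cantor → ℕ → ℕ} (hF : TotalRec F) : TotalRec fun p n => F p n + 1 :=
  comp (of_computable Computable.succ) hF

theorem pred {F : Cantor → ℕ → ℕ} (hF : TotalRec F) : TotalRec fun p n => F p n - 1 :=
  comp (of_computable Computable.pred) hF

theorem ite {F G H : Cantor → ℕ → ℕ} (hF : TotalRec F) (hG : TotalRec G) (hH : TotalRec H) :
    TotalRec fun p n => if F p n = 0 then G p n else H p n := by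
  have h : Computable₂ fun a b : ℕ => if a = 0 then b.unpair.1 else b.unpair.2 := by
    refine Primrec.to_comp (f := fun x : ℕ × ℕ =>
      if x.1 = 0 then x.2.unpair.1 else x.2.unpair.2) ?_
    exact Primrec.ite (Primrec.eq.comp Primrec.fst (Primrec.const 0))
      (Primrec.fst.comp (Primrec.unpair.comp Primrec.snd))
      (Primrec.snd.comp (Primrec.unpair.comp Primrec.snd))
  exact (comp₂ h hF (hG.pair hH)).of_eq fun p n => by simp

theorem iteEq {A B G H : Cantor → ℕ → ℕ} (hA : TotalRec A) (hB : TotalRec B) (hG : TotalRec G)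
    (hH : TotalRec H) : TotalRec fun p n => if A p n = B p n then G p n else H p n := by
  have h : Computable₂ fun a b : ℕ => if a = b then 0 else 1 :=
    Primrec.to_comp (f := fun x : ℕ × ℕ => if x.1 = x.2 then 0 else 1)
      (Primrec.ite (Primrec.eq.comp Primrec.fst Primrec.snd) (Primrec.const 0) (Primrec.const 1))
  refine (ite (comp₂ h hA hB) hG hH).of_eq fun p n => ?_
  by_cases e : A p n = B p n <;> simp [e]

theorem prec {F H : Cantor → ℕ → ℕ} (hF : TotalRec F) (hH : TotalRec H) :
    TotalRec fun p m => Nat.rec (F p (Nat.unpair m).1)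
      (fun y i => H p (Nat.pair (Nat.unpair m).1 (Nat.pair y i))) (Nat.unpair m).2 := by
  refine (OracleRec.prec hF hH).of_eq fun p m => ?_
  beta_reduce
  generalize (Nat.unpair m).2 = n
  induction n with
  | zero => rfl
  | succ k ih => simp only [ih, Part.bind_some]

end TotalRec

theorem mem_rfind_iff {f : ℕ →. Bool} {n : ℕ} :
    n ∈ Nat.rfind f ↔ true ∈ f n ∧ ∀ m < n, false ∈ f m :=
  ⟨fun h => ⟨(Nat.mem_rfind.1 h).1, fun _ hm => (Nat.mem_rfind.1 h).2 hm⟩,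
    fun h => Nat.mem_rfind.2 ⟨h.1, fun {m} hm => h.2 m hm⟩⟩

/-- Unbounded search over stages. -/
theorem OracleRec.of_stage {G : Cantor → ℕ → ℕ} (hG : TotalRec G) :
    ∃ T, OracleRec T ∧ ∀ p n v, v ∈ T p n ↔
      ∃ k, G p (Nat.pair n k) = v + 1 ∧ ∀ j < k, G p (Nat.pair n j) = 0 := by
  have h1 := OracleRec.rfind (TotalRec.ite hG (TotalRec.const 1) (TotalRec.const 0))
  have h2 := OracleRec.comp (TotalRec.pred hG) (OracleRec.pair TotalRec.id h1)
  refine ⟨_, h2, fun p n v => ?_⟩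
  simp only [Part.mem_bind_iff, Part.mem_some_iff, Part.bind_some, Part.mem_map_iff,
    Part.map_some]
  constructor
  · rintro ⟨a, ⟨k, hk', rfl⟩, rfl⟩
    obtain ⟨hk, hlt⟩ := mem_rfind_iff.1 hk'
    refine ⟨k, ?_, fun j hj => ?_⟩
    · by_contra h
      have : G p (Nat.pair n k) = 0 := by omega
      simp [this] at hk
    · by_contra h
      have := hlt j hj
      simp [h] at this
  · rintro ⟨k, hk, hlt⟩
    exact ⟨_, ⟨k, mem_rfind_iff.2 ⟨by simp [hk], fun j hj => by simp [hlt j hj]⟩, rfl⟩,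
      by simp [hk]⟩

/-- Computations in stages: `G p ⟨n, k⟩` is `v + 1` if `T^p(n) = v` has been found by stage `k`,
and `0` if nothing has been found. -/
theorem OracleRec.exists_stage {T : Cantor → ℕ →. ℕ} (hT : OracleRec T) :
    ∃ G, TotalRec G ∧
      (∀ p n v, v ∈ T p n ↔ ∃ k, G p (Nat.pair n k) = v + 1) ∧
      (∀ p n v k l, k ≤ l → G p (Nat.pair n k) = v + 1 → G p (Nat.pair n l) = v + 1) := by
  have tot : ∀ F : Cantor → ℕ → ℕ, TotalRec F → ∃ G, TotalRec G ∧
      (∀ p n v, v ∈ Part.some (F p n) ↔ ∃ k, G p (Nat.pair n k) = v + 1) ∧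
      (∀ p n v k l, k ≤ l → G p (Nat.pair n k) = v + 1 → G p (Nat.pair n l) = v + 1) := by
    intro F hF
    refine ⟨fun p m => F p m.unpair.1 + 1, (hF.comp TotalRec.id.fst).succ, ?_, ?_⟩
    · intro p n v
      simp [eq_comm]
    · intro p n v k l _ h
      simpa using h
  induction hT with
  | zero => exact tot _ OracleRec.zero
  | succ => exact tot _ OracleRec.succ
  | left => exact tot _ OracleRec.left
  | right => exact tot _ OracleRec.right
  | oracle => exact tot _ OracleRec.oracle
  | pair _ _ ih1 ih2 =>
    obtain ⟨G, hG, hG1, hG2⟩ := ih1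
    obtain ⟨H, hH, hH1, hH2⟩ := ih2
    refine ⟨fun p m => if G p m = 0 then 0 else if H p m = 0 then 0 else
      Nat.pair (G p m - 1) (H p m - 1) + 1,
      hG.ite (TotalRec.const 0) (hH.ite (TotalRec.const 0) (hG.pred.pair hH.pred).succ), ?_, ?_⟩
    · intro p n v
      simp only [Part.mem_bind_iff, Part.mem_map_iff]
      constructor
      · rintro ⟨a, ha, b, hb, rfl⟩
        obtain ⟨k, hk⟩ := (hG1 p n a).1 ha
        obtain ⟨l, hl⟩ := (hH1 p n b).1 hb
        refine ⟨max k l, ?_⟩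
        simp [hG2 p n a k _ (le_max_left k l) hk, hH2 p n b l _ (le_max_right k l) hl]
      · rintro ⟨k, hk⟩
        split_ifs at hk with h1 h2
        refine ⟨G p (Nat.pair n k) - 1, (hG1 _ _ _).2 ⟨k, by omega⟩,
          H p (Nat.pair n k) - 1, (hH1 _ _ _).2 ⟨k, by omega⟩, by omega⟩
    · intro p n v k l hkl hk
      beta_reduce at hk ⊢
      split_ifs at hk with h1 h2
      have e1 := hG2 p n (G p (Nat.pair n k) - 1) k l hkl (by omega)
      have e2 := hH2 p n (H p (Nat.pair n k) - 1) k l hkl (by omega)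
      simp only [e1, e2]
      simpa using hk
  | comp _ _ ih1 ih2 =>
    obtain ⟨G, hG, hG1, hG2⟩ := ih1
    obtain ⟨H, hH, hH1, hH2⟩ := ih2
    refine ⟨fun p m => if H p m = 0 then 0 else G p (Nat.pair (H p m - 1) m.unpair.2),
      hH.ite (TotalRec.const 0) (hG.comp (hH.pred.pair TotalRec.id.snd)), ?_, ?_⟩
    · intro p n v
      simp only [Part.mem_bind_iff]
      constructor
      · rintro ⟨a, ha, hv⟩
        obtain ⟨k, hk⟩ := (hH1 p n a).1 ha
        obtain ⟨l, hl⟩ := (hG1 p a v).1 hv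
        refine ⟨max k l, ?_⟩
        simp [hH2 p n a k _ (le_max_left k l) hk, hG2 p a v l _ (le_max_right k l) hl]
      · rintro ⟨k, hk⟩
        split_ifs at hk with h1
        refine ⟨H p (Nat.pair n k) - 1, (hH1 _ _ _).2 ⟨k, by omega⟩,
          (hG1 _ _ _).2 ⟨k, by simpa using hk⟩⟩
    · intro p n v k l hkl hk
      beta_reduce at hk ⊢
      split_ifs at hk with h1
      have e1 := hH2 p n (H p (Nat.pair n k) - 1) k l hkl (by omega)
      have e2 := hG2 p (H p (Nat.pair n k) - 1) v k l hkl (by simpa using hk)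
      simp only [e1]
      simpa using e2
  | @prec f h _ _ ih1 ih2 =>
    obtain ⟨G, hG, hG1, hG2⟩ := ih1
    obtain ⟨H, hH, hH1, hH2⟩ := ih2
    obtain ⟨R, hR0, hR1, hR⟩ : ∃ R : Cantor → ℕ → ℕ → ℕ → ℕ,
        (∀ p a k, R p a k 0 = G p (Nat.pair a k)) ∧
        (∀ p a k y, R p a k (y + 1) = if R p a k y = 0 then 0 else
          H p (Nat.pair (Nat.pair a (Nat.pair y (R p a k y - 1))) k)) ∧
        TotalRec fun p m => R p m.unpair.1.unpair.1 m.unpair.2 m.unpair.1.unpair.2 := by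
      refine ⟨fun p a k n => Nat.rec (G p (Nat.pair a k)) (fun y i => if i = 0 then 0 else
        H p (Nat.pair (Nat.pair a (Nat.pair y (i - 1))) k)) n, fun _ _ _ => rfl,
        fun _ _ _ _ => rfl, ?_⟩
      have s : TotalRec fun p m => if m.unpair.2.unpair.2 = 0 then 0 else
          H p (Nat.pair (Nat.pair m.unpair.1.unpair.1 (Nat.pair m.unpair.2.unpair.1
            (m.unpair.2.unpair.2 - 1))) m.unpair.1.unpair.2) :=
        TotalRec.id.snd.snd.ite (TotalRec.const 0) (hH.comp
          ((TotalRec.id.fst.fst.pair (TotalRec.id.snd.fst.pair TotalRec.id.snd.snd.pred)).pair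
            TotalRec.id.fst.snd))
      refine ((TotalRec.prec hG s).comp ((TotalRec.id.fst.fst.pair TotalRec.id.snd).pair
        TotalRec.id.fst.snd)).of_eq fun p m => ?_
      simp
    have mono : ∀ p a n v k l, k ≤ l → R p a k n = v + 1 → R p a l n = v + 1 := by
      intro p a n v k l hkl
      induction n generalizing v with
      | zero => simpa only [hR0] using hG2 p a v k l hkl
      | succ y ih =>
        intro hk
        rw [hR1] at hk
        split_ifs at hk with h1
        have e1 := ih (R p a k y - 1) (by omega)
        rw [hR1, e1]
        simpa using hH2 p _ v k l hkl hk
    refine ⟨_, hR, ?_, ?_⟩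
    · intro p m v
      simp only [Nat.unpair_pair]
      generalize (Nat.unpair m).1 = a
      generalize (Nat.unpair m).2 = n
      induction n generalizing v with
      | zero => simp only [hR0]; exact hG1 p a v
      | succ y ih =>
        simp only [Part.mem_bind_iff]
        constructor
        · rintro ⟨i, hi, hv⟩
          obtain ⟨k, hk⟩ := (ih i).1 hi
          obtain ⟨l, hl⟩ := (hH1 p _ v).1 hv
          refine ⟨max k l, ?_⟩
          rw [hR1, mono p a y i k _ (le_max_left k l) hk]
          simpa using hH2 p _ v l _ (le_max_right k l) hl
        · rintro ⟨k, hk⟩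
          rw [hR1] at hk
          split_ifs at hk with h1
          exact ⟨R p a k y - 1, (ih _).2 ⟨k, by omega⟩, (hH1 _ _ _).2 ⟨k, hk⟩⟩
    · intro p m v k l hkl hk
      simp only [Nat.unpair_pair] at hk ⊢
      exact mono _ _ _ _ _ _ hkl hk
  | @rfind f _ ih =>
    obtain ⟨G, hG, hG1, hG2⟩ := ih
    -- `0`: still searching; `1`: stuck; `v + 2`: the least zero `v` has been found
    obtain ⟨R, hR0, hR1, hR⟩ : ∃ R : Cantor → ℕ → ℕ → ℕ → ℕ, (∀ p a k, R p a k 0 = 0) ∧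
        (∀ p a k y, R p a k (y + 1) = if R p a k y = 0 then
          (if G p (Nat.pair (Nat.pair a y) k) = 0 then 1 else
            if G p (Nat.pair (Nat.pair a y) k) = 1 then y + 2 else 0) else R p a k y) ∧
        TotalRec fun p m => R p m.unpair.1 m.unpair.2 m.unpair.2 := by
      refine ⟨fun p a k n => Nat.rec 0 (fun y i => if i = 0 then
        (if G p (Nat.pair (Nat.pair a y) k) = 0 then 1 else
          if G p (Nat.pair (Nat.pair a y) k) = 1 then y + 2 else 0) else i) n, fun _ _ _ => rfl,
        fun _ _ _ _ => rfl, ?_⟩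
      have g : TotalRec fun p m => G p (Nat.pair (Nat.pair m.unpair.1.unpair.1
          m.unpair.2.unpair.1) m.unpair.1.unpair.2) :=
        hG.comp ((TotalRec.id.fst.fst.pair TotalRec.id.snd.fst).pair TotalRec.id.fst.snd)
      have s := TotalRec.id.snd.snd.ite (g.ite (TotalRec.const 1)
        (g.iteEq (TotalRec.const 1) TotalRec.id.snd.fst.succ.succ (TotalRec.const 0)))
        TotalRec.id.snd.snd
      refine ((TotalRec.prec (TotalRec.const 0) s).comp ((TotalRec.id.fst.pair
        TotalRec.id.snd).pair TotalRec.id.snd)).of_eq fun p m => ?_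
      simp
    have zero_iff : ∀ p a k n, R p a k n = 0 ↔ ∀ y < n, 2 ≤ G p (Nat.pair (Nat.pair a y) k) := by
      intro p a k n
      induction n with
      | zero => simp [hR0]
      | succ y ih =>
        rw [hR1]
        constructor
        · intro h z hz
          split_ifs at h with h1 h2 h3
          · rcases Nat.lt_succ_iff_lt_or_eq.1 hz with h4 | rfl
            · exact ih.1 h1 z h4
            · omega
          · exact absurd h h1
        · intro h
          have h1 := ih.2 fun z hz => h z (by omega)
          have h2 := h y (by omega)
          rw [if_pos h1, if_neg (by omega), if_neg (by omega)]
    have found_iff : ∀ p a k n v, R p a k n = v + 2 ↔ v < n ∧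
        G p (Nat.pair (Nat.pair a v) k) = 1 ∧
        ∀ y < v, 2 ≤ G p (Nat.pair (Nat.pair a y) k) := by
      intro p a k n v
      induction n with
      | zero => simp [hR0]
      | succ y ih =>
        rw [hR1]
        split_ifs with h1 h2 h3
        · have := (zero_iff p a k y).1 h1
          refine ⟨fun h => by omega, fun ⟨h4, h5, h6⟩ => ?_⟩
          rcases Nat.lt_succ_iff_lt_or_eq.1 h4 with h7 | rfl
          · have := this v h7; omega
          · omega
        · have := (zero_iff p a k y).1 h1
          constructor
          · intro h
            obtain rfl : v = y := by omega
            exact ⟨by omega, h3, this⟩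
          · rintro ⟨h4, h5, h6⟩
            rcases Nat.lt_succ_iff_lt_or_eq.1 h4 with h7 | rfl
            · have := this v h7; omega
            · rfl
        · have := (zero_iff p a k y).1 h1
          refine ⟨fun h => h.elim, fun ⟨h4, h5, h6⟩ => ?_⟩
          rcases Nat.lt_succ_iff_lt_or_eq.1 h4 with h7 | rfl
          · have := this v h7; omega
          · omega
        · rw [ih]
          refine ⟨fun ⟨h4, h5⟩ => ⟨by omega, h5⟩, fun ⟨h4, h5, h6⟩ => ⟨?_, h5, h6⟩⟩
          by_contra h7
          obtain rfl : v = y := by omega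
          exact h1 ((zero_iff p a k v).2 h6)
    have stage_mono : ∀ p a k l v, k ≤ l → G p (Nat.pair (Nat.pair a v) k) = 1 →
        G p (Nat.pair (Nat.pair a v) l) = 1 := fun p a k l v hkl h => hG2 p _ 0 k l hkl h
    have stage_mono' : ∀ p a k l v, k ≤ l → 2 ≤ G p (Nat.pair (Nat.pair a v) k) →
        2 ≤ G p (Nat.pair (Nat.pair a v) l) := fun p a k l v hkl h => by
      have := hG2 p (Nat.pair a v) (G p (Nat.pair (Nat.pair a v) k) - 1) k l hkl (by omega)
      omega
    refine ⟨_, hR.pred, ?_, ?_⟩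
    · intro p a v
      simp only [Nat.unpair_pair]
      refine mem_rfind_iff.trans ?_
      simp only [Part.mem_map_iff]
      have e : ∀ k, R p a k k - 1 = v + 1 ↔ R p a k k = v + 2 := fun k => by omega
      simp only [e, found_iff]
      constructor
      · rintro ⟨⟨m, hm, hm0⟩, hlt⟩
        obtain rfl : m = 0 := by simpa using hm0
        obtain ⟨k, hk⟩ := (hG1 _ _ _).1 hm
        have hlt' : ∀ y < v, ∃ k, 2 ≤ G p (Nat.pair (Nat.pair a y) k) := by
          intro y hy
          obtain ⟨m, hm, hm0⟩ := hlt y hy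
          obtain ⟨k, hk⟩ := (hG1 _ _ _).1 hm
          have : m ≠ 0 := by simpa using hm0
          exact ⟨k, by omega⟩
        choose! K hK using hlt'
        refine ⟨k + v + 1 + (Finset.range v).sup K, by omega,
          stage_mono p a k _ v (by omega) hk, fun y hy => ?_⟩
        have : K y ≤ (Finset.range v).sup K := Finset.le_sup (Finset.mem_range.2 hy)
        exact stage_mono' p a (K y) _ y (by omega) (hK y hy)
      · rintro ⟨k, -, hk, hlt⟩
        refine ⟨⟨0, (hG1 _ _ _).2 ⟨k, hk⟩, by simp⟩, fun y hy => ?_⟩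
        have := hlt y hy
        exact ⟨G p (Nat.pair (Nat.pair a y) k) - 1, (hG1 _ _ _).2 ⟨k, by omega⟩,
          by simp; omega⟩
    · intro p a v k l hkl
      simp only [Nat.unpair_pair]
      have e : ∀ k, R p a k k - 1 = v + 1 ↔ R p a k k = v + 2 := fun k => by omega
      simp only [e, found_iff]
      rintro ⟨h1, h2, h3⟩
      exact ⟨by omega, stage_mono p a k l v hkl h2,
        fun y hy => stage_mono' p a k l y hkl (h3 y hy)⟩

theorem OracleRec.of_stage_unique {G : Cantor → ℕ → ℕ} (hG : TotalRec G) :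
    ∃ T, OracleRec T ∧ ∀ p n,
      (∀ v w k l, G p (Nat.pair n k) = v + 1 → G p (Nat.pair n l) = w + 1 → v = w) →
      ∀ v, v ∈ T p n ↔ ∃ k, G p (Nat.pair n k) = v + 1 := by
  obtain ⟨T, hT, h⟩ := OracleRec.of_stage hG
  refine ⟨T, hT, fun p n hu v => (h p n v).trans ⟨fun ⟨k, hk, _⟩ => ⟨k, hk⟩, ?_⟩⟩
  rintro ⟨k, hk⟩
  classical
  have hex : ∃ k, G p (Nat.pair n k) ≠ 0 := ⟨k, by omega⟩
  have hs := Nat.find_spec hex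
  refine ⟨Nat.find hex, ?_, fun j hj => not_not.1 (Nat.find_min hex hj)⟩
  have := hu v (G p (Nat.pair n (Nat.find hex)) - 1) k (Nat.find hex) hk (by omega)
  omega

theorem OracleRec.cond {c : Cantor → ℕ → ℕ} (hc : TotalRec c) {S T : Cantor → ℕ →. ℕ}
    (hS : OracleRec S) (hT : OracleRec T) : ∃ R, OracleRec R ∧
      (∀ p n, c p n = 0 → R p n = S p n) ∧ (∀ p n, c p n ≠ 0 → R p n = T p n) := by
  obtain ⟨G, hG, hG1, hG2⟩ := hS.exists_stage
  obtain ⟨H, hH, hH1, hH2⟩ := hT.exists_stage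
  obtain ⟨R, hR, hR1⟩ := OracleRec.of_stage_unique ((hc.comp TotalRec.id.fst).ite hG hH)
  refine ⟨R, hR, fun p n h => ?_, fun p n h => ?_⟩
  · ext v
    rw [hR1 p n, hG1 p n v]
    · simp [h]
    · intro v w k l hv hw
      simp only [Nat.unpair_pair, h, if_true] at hv hw
      exact Part.mem_unique ((hG1 _ _ _).2 ⟨k, hv⟩) ((hG1 _ _ _).2 ⟨l, hw⟩)
  · ext v
    rw [hR1 p n, hH1 p n v]
    · simp [h]
    · intro v w k l hv hw
      simp only [Nat.unpair_pair, h, if_false] at hv hw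
      exact Part.mem_unique ((hH1 _ _ _).2 ⟨k, hv⟩) ((hH1 _ _ _).2 ⟨l, hw⟩)

/-- The oracle program `T` computes the point `q` from the oracle `p`. -/
def Computes (T : Cantor → ℕ →. ℕ) (p q : Cantor) : Prop := ∀ n, (q n).toNat ∈ T p n

theorem Computes.eq {T : Cantor → ℕ →. ℕ} {p q r : Cantor} (hq : Computes T p q)
    (hr : Computes T p r) : q = r := by
  funext n
  have := Part.mem_unique (hq n) (hr n)
  revert this
  cases q n <;> cases r n <;> simp

theorem OracleRec.exists_functional {T : Cantor → ℕ →. ℕ} (hT : OracleRec T) :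
    ∃ F, IsTuringFunctional F ∧ ∀ p q, q ∈ F p ↔ Computes T p q := by
  have h : ∀ p q, q ∈ (⟨∃ q, Computes T p q, fun h => h.choose⟩ : Part Cantor) ↔
      Computes T p q := fun p q =>
    ⟨fun ⟨h, e⟩ => e ▸ h.choose_spec, fun h => ⟨⟨q, h⟩, (Exists.choose_spec ⟨q, h⟩).eq h⟩⟩
  exact ⟨_, ⟨T, hT, h⟩, h⟩

/-- Substitution of the output of a program as the oracle of another one. -/
theorem OracleRec.subst {S T : Cantor → ℕ →. ℕ} (hS : OracleRec S) (hT : OracleRec T) :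
    ∃ R, OracleRec R ∧ ∀ p q, Computes T p q → R p = S q := by
  induction hS with
  | zero => exact ⟨_, OracleRec.zero, fun _ _ _ => rfl⟩
  | succ => exact ⟨_, OracleRec.succ, fun _ _ _ => rfl⟩
  | left => exact ⟨_, OracleRec.left, fun _ _ _ => rfl⟩
  | right => exact ⟨_, OracleRec.right, fun _ _ _ => rfl⟩
  | oracle => exact ⟨T, hT, fun p q h => funext fun n => Part.eq_some_iff.2 (h n)⟩
  | pair _ _ ih1 ih2 =>
    obtain ⟨R1, h1, e1⟩ := ih1
    obtain ⟨R2, h2, e2⟩ := ih2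
    exact ⟨_, OracleRec.pair h1 h2, fun p q h => by rw [e1 p q h, e2 p q h]⟩
  | comp _ _ ih1 ih2 =>
    obtain ⟨R1, h1, e1⟩ := ih1
    obtain ⟨R2, h2, e2⟩ := ih2
    exact ⟨_, OracleRec.comp h1 h2, fun p q h => by rw [e1 p q h, e2 p q h]⟩
  | prec _ _ ih1 ih2 =>
    obtain ⟨R1, h1, e1⟩ := ih1
    obtain ⟨R2, h2, e2⟩ := ih2
    exact ⟨_, OracleRec.prec h1 h2, fun p q h => by rw [e1 p q h, e2 p q h]⟩
  | rfind _ ih =>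
    obtain ⟨R, h, e⟩ := ih
    exact ⟨_, OracleRec.rfind h, fun p q h => by rw [e p q h]⟩

theorem OracleRec.exists_comp {S T : Cantor → ℕ →. ℕ} (hS : OracleRec S) (hT : OracleRec T) :
    ∃ R, OracleRec R ∧ ∀ p q r, Computes T p q → Computes S q r → Computes R p r := by
  obtain ⟨R, hR, h⟩ := hS.subst hT
  refine ⟨R, hR, fun p q r hq hr n => ?_⟩
  rw [h p q hq]
  exact hr n

theorem TotalRec.computes {F : Cantor → ℕ → ℕ} {p q : Cantor}
    (h : ∀ n, F p n = (q n).toNat) : Computes (fun p n => Part.some (F p n)) p q :=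
  fun n => Part.mem_some_iff.2 (h n).symm

theorem exists_id : ∃ T, OracleRec T ∧ ∀ p, Computes T p p :=
  ⟨_, OracleRec.oracle, fun _ => TotalRec.computes fun _ => rfl⟩

theorem cjoin_two_mul (p q : Cantor) (n : ℕ) : cjoin p q (2 * n) = p n := by
  simp [cjoin]

theorem cjoin_two_mul_add_one (p q : Cantor) (n : ℕ) : cjoin p q (2 * n + 1) = q n := by
  have h1 : (2 * n + 1) % 2 = 1 := by omega
  have h2 : (2 * n + 1) / 2 = n := by omega
  simp [cjoin, h1, h2]

theorem cjoin_inj {p q p' q' : Cantor} (h : cjoin p q = cjoin p' q') : p = p' ∧ q = q' := by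
  constructor
  · funext n
    rw [← cjoin_two_mul p q, h, cjoin_two_mul]
  · funext n
    rw [← cjoin_two_mul_add_one p q, h, cjoin_two_mul_add_one]

theorem tag_ne : tag 0 ≠ tag 1 := fun h => by
  have := congrFun h 0
  simp [tag] at this

theorem exists_fst : ∃ T, OracleRec T ∧ ∀ a b, Computes T (cjoin a b) a := by
  have h : Computable fun n : ℕ => 2 * n :=
    (Primrec.nat_mul.comp (Primrec.const 2) Primrec.id).to_comp
  exact ⟨_, TotalRec.oracle.comp (TotalRec.of_computable h), fun a b =>
    TotalRec.computes fun n => by rw [cjoin_two_mul]⟩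

theorem exists_snd : ∃ T, OracleRec T ∧ ∀ a b, Computes T (cjoin a b) b := by
  have h : Computable fun n : ℕ => 2 * n + 1 :=
    (Primrec.succ.comp (Primrec.nat_mul.comp (Primrec.const 2) Primrec.id)).to_comp
  exact ⟨_, TotalRec.oracle.comp (TotalRec.of_computable h), fun a b =>
    TotalRec.computes fun n => by rw [cjoin_two_mul_add_one]⟩

theorem exists_tag (i : ℕ) : ∃ T, OracleRec T ∧ ∀ p, Computes T p (tag i) := by
  refine ⟨_, TotalRec.id.iteEq (TotalRec.const i) (TotalRec.const 1) (TotalRec.const 0),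
    fun p => TotalRec.computes fun n => ?_⟩
  by_cases h : n = i <;> simp [tag, h]

theorem exists_cjoin {S T : Cantor → ℕ →. ℕ} (hS : OracleRec S) (hT : OracleRec T) :
    ∃ R, OracleRec R ∧ ∀ p a b, Computes S p a → Computes T p b → Computes R p (cjoin a b) := by
  have h2 : TotalRec fun _ n => n / 2 :=
    TotalRec.of_computable (Primrec.nat_div.comp Primrec.id (Primrec.const 2)).to_comp
  have h3 : TotalRec fun _ n => n % 2 :=
    TotalRec.of_computable (Primrec.nat_mod.comp Primrec.id (Primrec.const 2)).to_comp
  obtain ⟨R, hR, h0, h1⟩ := OracleRec.cond h3 (OracleRec.comp hS h2) (OracleRec.comp hT h2)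
  refine ⟨R, hR, fun p a b ha hb n => ?_⟩
  by_cases h : n % 2 = 0
  · rw [h0 p n h]
    simpa [cjoin, h] using ha (n / 2)
  · rw [h1 p n h]
    simpa [cjoin, h] using hb (n / 2)

theorem exists_addTag (i : ℕ) : ∃ T, OracleRec T ∧ ∀ p, Computes T p (cjoin (tag i) p) := by
  obtain ⟨S, hS, h1⟩ := exists_tag i
  obtain ⟨T, hT, h2⟩ := exists_id
  obtain ⟨R, hR, h3⟩ := exists_cjoin hS hT
  exact ⟨R, hR, fun p => h3 _ _ _ (h1 p) (h2 p)⟩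

/-- Case distinction on the tag of the oracle. -/
theorem exists_cases {S T : Cantor → ℕ →. ℕ} (hS : OracleRec S) (hT : OracleRec T) :
    ∃ R, OracleRec R ∧
      (∀ p q, Computes S p q → Computes R (cjoin (tag 0) p) q) ∧
      (∀ p q, Computes T p q → Computes R (cjoin (tag 1) p) q) := by
  obtain ⟨P, hP, hP1⟩ := exists_snd
  obtain ⟨S', hS', hS1⟩ := hS.exists_comp hP
  obtain ⟨T', hT', hT1⟩ := hT.exists_comp hP
  obtain ⟨R, hR, h0, h1⟩ := OracleRec.cond (TotalRec.oracle.comp (TotalRec.const 0)) hT' hS'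
  refine ⟨R, hR, fun p q h n => ?_, fun p q h n => ?_⟩
  · rw [h1 _ n (by simp [cjoin, tag])]
    exact hS1 _ _ _ (hP1 _ _) h n
  · rw [h0 _ n (by simp [cjoin, tag])]
    exact hT1 _ _ _ (hP1 _ _) h n

theorem triple_inj {n s i n' s' i' : ℕ} (h : triple n s i = triple n' s' i') :
    n = n' ∧ s = s' ∧ i = i' := by
  simpa [triple, Nat.pair_eq_pair] using h

open Classical in
theorem mem_approxEval {a y : Cantor} : y ∈ approxEval a ↔
    IsMonotoneApprox a ∧ ∀ n, ∃ s, a (triple n s (y n).toNat) = true := by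
  constructor
  · rintro ⟨⟨hm, ht⟩, rfl⟩
    refine ⟨hm, fun n => ?_⟩
    obtain ⟨s, i, hi, h⟩ := ht n
    refine ⟨s, ?_⟩
    simp only [approxEval]
    by_cases h1 : ∃ s, a (triple n s 1) = true
    · obtain ⟨t, h2⟩ := h1
      obtain ⟨rfl, rfl⟩ := hm.unique n s t i 1 hi (by omega) h h2
      rw [decide_eq_true ⟨s, h⟩]
      exact h
    · have : i ≠ 1 := by
        rintro rfl
        exact h1 ⟨s, h⟩
      obtain rfl : i = 0 := by omega
      rw [decide_eq_false h1]
      exact h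
  · rintro ⟨hm, ht⟩
    refine ⟨⟨hm, fun n => ?_⟩, ?_⟩
    · obtain ⟨s, h⟩ := ht n
      exact ⟨s, _, Bool.toNat_lt _, h⟩
    · funext n
      obtain ⟨s, h⟩ := ht n
      simp only [approxEval]
      cases hy : y n with
      | true =>
        rw [hy] at h
        exact decide_eq_true ⟨s, h⟩
      | false =>
        rw [hy] at h
        refine decide_eq_false ?_
        rintro ⟨t, h2⟩
        have := (hm.unique n s t 0 1 (by omega) (by omega) h h2).2
        omega

theorem exists_eval : ∃ T, OracleRec T ∧ ∀ a y, y ∈ approxEval a → Computes T a y := by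
  have look : ∀ i, TotalRec fun p m => (p (triple m.unpair.1 m.unpair.2 i)).toNat := fun i =>
    TotalRec.oracle.comp (TotalRec.id.fst.pair (TotalRec.id.snd.pair (TotalRec.const i)))
  obtain ⟨T, hT, h⟩ := OracleRec.of_stage_unique
    (((look 0).iteEq (TotalRec.const 1) (TotalRec.const 1)
      ((look 1).iteEq (TotalRec.const 1) (TotalRec.const 2) (TotalRec.const 0))))
  refine ⟨T, hT, fun a y hy n => ?_⟩
  obtain ⟨hm, ht⟩ := mem_approxEval.1 hy
  simp only [Nat.unpair_pair, Bool.toNat_eq_one] at h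
  obtain ⟨s, hs⟩ := ht n
  have key : ∀ k v, ((if a (triple n k 0) = true then 1 else
      if a (triple n k 1) = true then 2 else 0) = v + 1) → v = (y n).toNat := by
    intro k v hv
    split_ifs at hv with h1 h2
    · have := (hm.unique n s k _ 0 (Bool.toNat_lt _) (by omega) hs h1).2
      omega
    · have := (hm.unique n s k _ 1 (Bool.toNat_lt _) (by omega) hs h2).2
      omega
  refine (h a n (fun v w k l hv hw => (key k v hv).trans (key l w hw).symm) _).2 ⟨s, ?_⟩
  cases hyn : y n with
  | true =>
    rw [hyn] at hs
    have h0 : ¬ a (triple n s 0) = true := fun h0 => by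
      have := (hm.unique n s s 1 0 (by omega) (by omega) hs h0).2
      omega
    exact (if_neg h0).trans (if_pos hs)
  | false =>
    rw [hyn] at hs
    exact if_pos hs

/-- The monotone approximation that is produced by a computation. -/
theorem exists_approx {T : Cantor → ℕ →. ℕ} (hT : OracleRec T) :
    ∃ A, OracleRec A ∧ ∀ q, ∃ a, Computes A q a ∧ ∀ r, Computes T q r → r ∈ approxEval a := by
  obtain ⟨G, hG, hG1, hG2⟩ := hT.exists_stage
  obtain ⟨L, hL0, hL1, hL⟩ : ∃ L : Cantor → ℕ → ℕ, (∀ q, L q 0 = 0) ∧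
      (∀ q s, L q (s + 1) = if G q (Nat.pair (L q s) s) = 1 then L q s + 1 else
        if G q (Nat.pair (L q s) s) = 2 then L q s + 1 else L q s) ∧ TotalRec L := by
    refine ⟨fun q s => Nat.rec 0 (fun s l => if G q (Nat.pair l s) = 1 then l + 1 else
        if G q (Nat.pair l s) = 2 then l + 1 else l) s, fun _ => rfl, fun _ _ => rfl, ?_⟩
    have g := hG.comp (TotalRec.id.snd.snd.pair TotalRec.id.snd.fst)
    have st := g.iteEq (TotalRec.const 1) TotalRec.id.snd.snd.succ
      (g.iteEq (TotalRec.const 2) TotalRec.id.snd.snd.succ TotalRec.id.snd.snd)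
    exact ((TotalRec.prec (TotalRec.const 0) st).comp
      ((TotalRec.const 0).pair TotalRec.id)).of_eq fun p m => by simp
  have hLle : ∀ q s, L q s ≤ L q (s + 1) := fun q s => by
    rw [hL1]; split_ifs <;> omega
  have hLmono : ∀ q, Monotone (L q) := fun q => monotone_nat_of_le_succ (hLle q)
  have i := TotalRec.id.snd.snd
  have hA := (hL.comp TotalRec.id.snd.fst).iteEq TotalRec.id.fst
    ((hG.comp (TotalRec.id.fst.pair TotalRec.id.snd.fst)).iteEq i.succ
      (i.ite (TotalRec.const 1) (i.iteEq (TotalRec.const 1) (TotalRec.const 1)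
        (TotalRec.const 0))) (TotalRec.const 0)) (TotalRec.const 0)
  refine ⟨_, hA, fun q => ?_⟩
  let a : Cantor := fun m => decide (L q m.unpair.2.unpair.1 = m.unpair.1 ∧
    G q (Nat.pair m.unpair.1 m.unpair.2.unpair.1) = m.unpair.2.unpair.2 + 1 ∧
    m.unpair.2.unpair.2 < 2)
  have ha : ∀ n s i, a (triple n s i) = true ↔
      L q s = n ∧ G q (Nat.pair n s) = i + 1 ∧ i < 2 := by
    intro n s i
    simp [a, triple]
  refine ⟨a, TotalRec.computes fun m => ?_, fun r hr => ?_⟩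
  · by_cases h1 : L q m.unpair.2.unpair.1 = m.unpair.1
    · by_cases h2 : G q (Nat.pair m.unpair.1 m.unpair.2.unpair.1) = m.unpair.2.unpair.2 + 1
      · by_cases h3 : m.unpair.2.unpair.2 = 0
        · simp [a, h1, h2, h3]
        · by_cases h4 : m.unpair.2.unpair.2 = 1
          · simp [a, h1, h2, h4]
          · have h5 : ¬ m.unpair.2.unpair.2 ≤ 1 := by omega
            simp [a, h1, h2, h3, h4, h5]
      · simp [a, h1, h2]
    · simp [a, h1]
  · have hstep : ∀ n s i, a (triple n s i) = true → L q (s + 1) = n + 1 := by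
      intro n s i h
      obtain ⟨rfl, h2, h3⟩ := (ha n s i).1 h
      rw [hL1]
      split_ifs <;> omega
    have hval : ∀ n s i, G q (Nat.pair n s) = i + 1 → i = (r n).toNat := fun n s i h =>
      Part.mem_unique ((hG1 q n i).2 ⟨s, h⟩) (hr n)
    have hfind : ∀ n, (∃ s, L q s = n) → ∃ s, a (triple n s (r n).toNat) = true := by
      rintro n ⟨s₀, hs₀⟩
      have hlt : (r n).toNat < 2 := Bool.toNat_lt _
      by_contra hno
      push Not at hno
      have hstay : ∀ d, L q (s₀ + d) = n := by
        intro d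
        induction d with
        | zero => exact hs₀
        | succ d ih =>
          have hne : G q (Nat.pair n (s₀ + d)) ≠ (r n).toNat + 1 := fun h =>
            hno (s₀ + d) ((ha _ _ _).2 ⟨ih, h, hlt⟩)
          rw [← add_assoc, hL1, ih]
          split_ifs with h1 h2
          · have := hval n (s₀ + d) 0 h1; omega
          · have := hval n (s₀ + d) 1 h2; omega
          · rfl
      obtain ⟨k, hk⟩ := (hG1 q n _).1 (hr n)
      exact hno (s₀ + k) ((ha _ _ _).2 ⟨hstay k, hG2 q n _ k _ (by omega) hk, hlt⟩)
    have hreach : ∀ n, ∃ s, L q s = n := by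
      intro n
      induction n with
      | zero => exact ⟨0, hL0 q⟩
      | succ n ih =>
        obtain ⟨s, hs⟩ := hfind n ih
        exact ⟨s + 1, hstep _ _ _ hs⟩
    refine mem_approxEval.2 ⟨⟨?_, ?_, ?_⟩, fun n => hfind n (hreach n)⟩
    · intro m hm
      have e : m = triple m.unpair.1 m.unpair.2.unpair.1 m.unpair.2.unpair.2 := by
        simp [triple]
      rw [e] at hm
      exact ⟨_, _, _, ((ha _ _ _).1 hm).2.2, e⟩
    · intro n s t i j _ _ h1 h2
      obtain ⟨hs, hsi, -⟩ := (ha _ _ _).1 h1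
      obtain ⟨ht, htj, -⟩ := (ha _ _ _).1 h2
      have hs' := hstep _ _ _ h1
      have ht' := hstep _ _ _ h2
      obtain rfl : s = t := by
        rcases lt_trichotomy s t with h | h | h
        · have := hLmono q (Nat.succ_le_of_lt h)
          simp only [Nat.succ_eq_add_one] at this
          omega
        · exact h
        · have := hLmono q (Nat.succ_le_of_lt h)
          simp only [Nat.succ_eq_add_one] at this
          omega
      exact ⟨rfl, by omega⟩
    · intro m n s t i j _ _ h1 h2 hmn
      obtain ⟨hs, -, -⟩ := (ha _ _ _).1 h1
      obtain ⟨ht, -, -⟩ := (ha _ _ _).1 h2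
      by_contra h
      have := hLmono q (not_lt.1 h)
      omega

/-! ## The lattice of strong Weihrauch degrees -/

namespace Problem

theorem mem_comp_comp {Φ G Ψ : Cantor →. Cantor} {p r : Cantor} :
    r ∈ Ψ.comp (G.comp Φ) p ↔ ∃ p' ∈ Φ p, ∃ q ∈ G p', r ∈ Ψ q := by
  rw [PFun.comp_apply]
  refine Part.mem_bind_iff.trans ⟨?_, ?_⟩
  · rintro ⟨q, hq, hr⟩
    rw [PFun.comp_apply] at hq
    obtain ⟨p', hp', hq⟩ := Part.mem_bind_iff.1 hq
    exact ⟨p', hp', q, hq, hr⟩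
  · rintro ⟨p', hp', q, hq, hr⟩
    refine ⟨q, ?_, hr⟩
    rw [PFun.comp_apply]
    exact Part.mem_bind_iff.2 ⟨p', hp', hq⟩

/-- Strong Weihrauch reducibility without mention of realizers. -/
theorem sWReducible_iff {f g : Problem} : SWReducible f g ↔
    ∃ S T, OracleRec S ∧ OracleRec T ∧ ∀ p ∈ f.dom, ∃ p' ∈ g.dom, Computes S p p' ∧
      ∀ q ∈ g.sol p', ∃ r ∈ f.sol p, Computes T q r := by
  constructor
  · rintro ⟨Φ, Ψ, ⟨S, hS, hΦ⟩, ⟨T, hT, hΨ⟩, h⟩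
    refine ⟨S, T, hS, hT, fun p hp => ?_⟩
    classical
    -- a realizer of `g` that is defined on `dom g` only and has a prescribed value at `p'`
    have real : ∀ p' q, (p' ∈ g.dom → q ∈ g.sol p') → ∃ G : Cantor →. Cantor, Realizes G g ∧
        (∀ x y, y ∈ G x → x ∈ g.dom) ∧ ∀ y ∈ G p', y = q := by
      intro p' q hq
      refine ⟨fun x => ⟨x ∈ g.dom, fun hx => if x = p' then q else hx.choose⟩, ?_, ?_, ?_⟩
      · intro x hx
        refine ⟨_, ⟨hx, rfl⟩, ?_⟩
        by_cases e : x = p'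
        · subst e
          simpa using hq hx
        · simp only [e, if_false]
          exact hx.choose_spec
      · rintro x y ⟨hx, -⟩
        exact hx
      · rintro y ⟨hx, rfl⟩
        simp
    obtain ⟨G, hG, hG1, -⟩ := real (fun _ => false) (Classical.epsilon fun q =>
      q ∈ g.sol fun _ => false) fun h => Classical.epsilon_spec h
    obtain ⟨r, hr, -⟩ := h G hG p hp
    obtain ⟨p', hp', q, hq, -⟩ := mem_comp_comp.1 hr
    refine ⟨p', hG1 _ _ hq, (hΦ _ _).1 hp', fun q hq => ?_⟩
    obtain ⟨G, hG, -, hG2⟩ := real p' q fun _ => hq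
    obtain ⟨r, hr, hrf⟩ := h G hG p hp
    obtain ⟨p'', hp'', q', hq', hr⟩ := mem_comp_comp.1 hr
    obtain rfl := Part.mem_unique hp' hp''
    obtain rfl := hG2 q' hq'
    exact ⟨r, hrf, (hΨ _ _).1 hr⟩
  · rintro ⟨S, T, hS, hT, h⟩
    obtain ⟨Φ, hΦ, hΦ1⟩ := hS.exists_functional
    obtain ⟨Ψ, hΨ, hΨ1⟩ := hT.exists_functional
    refine ⟨Φ, Ψ, hΦ, hΨ, fun G hG p hp => ?_⟩
    obtain ⟨p', hp', hS', hT'⟩ := h p hp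
    obtain ⟨q, hq, hqg⟩ := hG p' hp'
    obtain ⟨r, hr, hTr⟩ := hT' q hqg
    exact ⟨r, mem_comp_comp.2 ⟨p', (hΦ1 _ _).2 hS', q, hq, (hΨ1 _ _).2 hTr⟩, hr⟩

theorem SWReducible.refl (f : Problem) : SWReducible f f := by
  obtain ⟨S, hS, h⟩ := exists_id
  exact sWReducible_iff.2 ⟨S, S, hS, hS, fun p hp => ⟨p, hp, h p, fun q hq => ⟨q, hq, h q⟩⟩⟩

theorem SWReducible.trans {f g h : Problem} (hfg : SWReducible f g) (hgh : SWReducible g h) :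
    SWReducible f h := by
  obtain ⟨S, T, hS, hT, h1⟩ := sWReducible_iff.1 hfg
  obtain ⟨S', T', hS', hT', h2⟩ := sWReducible_iff.1 hgh
  obtain ⟨U, hU, hU1⟩ := hS'.exists_comp hS
  obtain ⟨V, hV, hV1⟩ := hT.exists_comp hT'
  refine sWReducible_iff.2 ⟨U, V, hU, hV, fun p hp => ?_⟩
  obtain ⟨p', hp', hS1, hT1⟩ := h1 p hp
  obtain ⟨p'', hp'', hS2, hT2⟩ := h2 p' hp'
  refine ⟨p'', hp'', hU1 _ _ _ hS1 hS2, fun q hq => ?_⟩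
  obtain ⟨r, hr, hr1⟩ := hT2 q hq
  obtain ⟨w, hw, hw1⟩ := hT1 r hr
  exact ⟨w, hw, hV1 _ _ _ hr1 hw1⟩

/-- Problems are preordered by strong Weihrauch reducibility. -/
instance : Preorder Problem where
  le := SWReducible
  le_refl := SWReducible.refl
  le_trans _ _ _ := SWReducible.trans

theorem meet_dom {f g : Problem} {r : Cantor} (hr : r ∈ (meet f g).dom) :
    ∃ p₀ ∈ f.dom, ∃ p₁ ∈ g.dom, r = cjoin p₀ p₁ := by
  obtain ⟨w, p₀, h0, p₁, h1, e, -⟩ := hr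
  exact ⟨p₀, h0, p₁, h1, e⟩

theorem meet_le_left (f g : Problem) : meet f g ≤ f := by
  obtain ⟨S, hS, h1⟩ := exists_fst
  obtain ⟨T, hT, h2⟩ := exists_addTag 0
  refine sWReducible_iff.2 ⟨S, T, hS, hT, fun r hr => ?_⟩
  obtain ⟨p₀, h0, p₁, h1', rfl⟩ := meet_dom hr
  exact ⟨p₀, h0, h1 _ _, fun q hq =>
    ⟨_, ⟨p₀, h0, p₁, h1', rfl, Or.inl ⟨q, hq, rfl⟩⟩, h2 q⟩⟩

theorem meet_le_right (f g : Problem) : meet f g ≤ g := by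
  obtain ⟨S, hS, h1⟩ := exists_snd
  obtain ⟨T, hT, h2⟩ := exists_addTag 1
  refine sWReducible_iff.2 ⟨S, T, hS, hT, fun r hr => ?_⟩
  obtain ⟨p₀, h0, p₁, h1', rfl⟩ := meet_dom hr
  exact ⟨p₁, h1', h1 _ _, fun q hq =>
    ⟨_, ⟨p₀, h0, p₁, h1', rfl, Or.inr ⟨q, hq, rfl⟩⟩, h2 q⟩⟩

theorem le_meet {f g h : Problem} (hf : h ≤ f) (hg : h ≤ g) : h ≤ meet f g := by
  obtain ⟨S, T, hS, hT, h1⟩ := sWReducible_iff.1 hf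
  obtain ⟨S', T', hS', hT', h2⟩ := sWReducible_iff.1 hg
  obtain ⟨U, hU, hU1⟩ := exists_cjoin hS hS'
  obtain ⟨V, hV, hV0, hV1⟩ := exists_cases hT hT'
  refine sWReducible_iff.2 ⟨U, V, hU, hV, fun p hp => ?_⟩
  obtain ⟨p₀, hp₀, hS1, hT1⟩ := h1 p hp
  obtain ⟨p₁, hp₁, hS2, hT2⟩ := h2 p hp
  refine ⟨cjoin p₀ p₁, ?_, hU1 _ _ _ hS1 hS2, ?_⟩
  · obtain ⟨q, hq⟩ := hp₀
    exact ⟨_, p₀, ⟨q, hq⟩, p₁, hp₁, rfl, Or.inl ⟨q, hq, rfl⟩⟩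
  · rintro w ⟨x₀, -, x₁, -, e, hw⟩
    obtain ⟨rfl, rfl⟩ := cjoin_inj e
    rcases hw with ⟨q, hq, rfl⟩ | ⟨q, hq, rfl⟩
    · obtain ⟨r, hr, hr1⟩ := hT1 q hq
      exact ⟨r, hr, hV0 _ _ hr1⟩
    · obtain ⟨r, hr, hr1⟩ := hT2 q hq
      exact ⟨r, hr, hV1 _ _ hr1⟩

theorem exists_mem_approxEval (y : Cantor) : ∃ a, y ∈ approxEval a := by
  obtain ⟨S, hS, h⟩ := exists_id
  obtain ⟨A, -, hA⟩ := exists_approx hS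
  obtain ⟨a, -, ha⟩ := hA y
  exact ⟨a, ha y (h y)⟩

theorem le_boxplus_left (f g : Problem) : f ≤ boxplus f g := by
  obtain ⟨S, hS, hS1⟩ := exists_addTag 0
  obtain ⟨P, hP, hP1⟩ := exists_fst
  obtain ⟨E, hE, hE1⟩ := exists_eval
  obtain ⟨T, hT, hT1⟩ := hE.exists_comp hP
  refine sWReducible_iff.2 ⟨S, T, hS, hT, fun p hp => ⟨cjoin (tag 0) p, ?_, hS1 p, ?_⟩⟩
  · obtain ⟨y, hy⟩ := hp
    obtain ⟨a, ha⟩ := exists_mem_approxEval y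
    exact ⟨cjoin a a, a, a, rfl, Or.inl ⟨p, rfl, y, ha, hy⟩⟩
  · rintro w ⟨a, b, rfl, ⟨p', e, y, hy, hyf⟩ | ⟨p', e, -⟩⟩
    · obtain ⟨-, rfl⟩ := cjoin_inj e
      exact ⟨y, hyf, hT1 _ _ _ (hP1 a b) (hE1 a y hy)⟩
    · exact absurd (cjoin_inj e).1 tag_ne

theorem le_boxplus_right (f g : Problem) : g ≤ boxplus f g := by
  obtain ⟨S, hS, hS1⟩ := exists_addTag 1
  obtain ⟨P, hP, hP1⟩ := exists_snd
  obtain ⟨E, hE, hE1⟩ := exists_eval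
  obtain ⟨T, hT, hT1⟩ := hE.exists_comp hP
  refine sWReducible_iff.2 ⟨S, T, hS, hT, fun p hp => ⟨cjoin (tag 1) p, ?_, hS1 p, ?_⟩⟩
  · obtain ⟨y, hy⟩ := hp
    obtain ⟨a, ha⟩ := exists_mem_approxEval y
    exact ⟨cjoin a a, a, a, rfl, Or.inr ⟨p, rfl, y, ha, hy⟩⟩
  · rintro w ⟨a, b, rfl, ⟨p', e, -⟩ | ⟨p', e, y, hy, hyg⟩⟩
    · exact absurd (cjoin_inj e).1.symm tag_ne
    · obtain ⟨-, rfl⟩ := cjoin_inj e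
      exact ⟨y, hyg, hT1 _ _ _ (hP1 a b) (hE1 b y hy)⟩

theorem boxplus_le {f g h : Problem} (hf : f ≤ h) (hg : g ≤ h) : boxplus f g ≤ h := by
  obtain ⟨S, T, hS, hT, h1⟩ := sWReducible_iff.1 hf
  obtain ⟨S', T', hS', hT', h2⟩ := sWReducible_iff.1 hg
  obtain ⟨U, hU, hU0, hU1⟩ := exists_cases hS hS'
  obtain ⟨A, hA, hA1⟩ := exists_approx hT
  obtain ⟨B, hB, hB1⟩ := exists_approx hT'
  obtain ⟨V, hV, hV1⟩ := exists_cjoin hA hB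
  refine sWReducible_iff.2 ⟨U, V, hU, hV, ?_⟩
  rintro r ⟨w, -, -, -, ⟨p, rfl, y, -, hy⟩ | ⟨p, rfl, y, -, hy⟩⟩
  · obtain ⟨p', hp', hS1, hT1⟩ := h1 p ⟨y, hy⟩
    refine ⟨p', hp', hU0 _ _ hS1, fun q hq => ?_⟩
    obtain ⟨r, hr, hr1⟩ := hT1 q hq
    obtain ⟨a, ha, ha1⟩ := hA1 q
    obtain ⟨b, hb, -⟩ := hB1 q
    exact ⟨cjoin a b, ⟨a, b, rfl, Or.inl ⟨p, rfl, r, ha1 r hr1, hr⟩⟩, hV1 _ _ _ ha hb⟩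
  · obtain ⟨p', hp', hS1, hT1⟩ := h2 p ⟨y, hy⟩
    refine ⟨p', hp', hU1 _ _ hS1, fun q hq => ?_⟩
    obtain ⟨r, hr, hr1⟩ := hT1 q hq
    obtain ⟨a, ha, -⟩ := hA1 q
    obtain ⟨b, hb, hb1⟩ := hB1 q
    exact ⟨cjoin a b, ⟨a, b, rfl, Or.inr ⟨p, rfl, r, hb1 r hr1, hr⟩⟩, hV1 _ _ _ ha hb⟩

end Problem

/-- The strong Weihrauch degrees: problems up to strong Weihrauch equivalence, with the order
that `≤_sW` induces. -/
abbrev SWDegree : Type := Antisymmetrization Problem (· ≤ ·)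

/-- The strong Weihrauch lattice: the join of the degrees of `f` and `g` is the degree of `f ⊞ g`,
and their meet is the degree of `f ⊓ g`. -/
instance : Lattice SWDegree where
  __ := (inferInstance : PartialOrder SWDegree)
  sup := Quotient.map₂ Problem.boxplus fun _ _ hf _ _ hg =>
    ⟨Problem.boxplus_le (hf.1.trans (Problem.le_boxplus_left _ _))
      (hg.1.trans (Problem.le_boxplus_right _ _)),
     Problem.boxplus_le (hf.2.trans (Problem.le_boxplus_left _ _))
      (hg.2.trans (Problem.le_boxplus_right _ _))⟩
  inf := Quotient.map₂ Problem.meet fun _ _ hf _ _ hg =>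
    ⟨Problem.le_meet ((Problem.meet_le_left _ _).trans hf.1)
      ((Problem.meet_le_right _ _).trans hg.1),
     Problem.le_meet ((Problem.meet_le_left _ _).trans hf.2)
      ((Problem.meet_le_right _ _).trans hg.2)⟩
  le_sup_left a b := Quotient.inductionOn₂ a b fun f g => Problem.le_boxplus_left f g
  le_sup_right a b := Quotient.inductionOn₂ a b fun f g => Problem.le_boxplus_right f g
  sup_le a b c := Quotient.inductionOn₃ a b c fun _ _ _ => Problem.boxplus_le
  inf_le_left a b := Quotient.inductionOn₂ a b fun f g => Problem.meet_le_left f g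
  inf_le_right a b := Quotient.inductionOn₂ a b fun f g => Problem.meet_le_right f g
  le_inf a b c := Quotient.inductionOn₃ a b c fun _ _ _ => Problem.le_meet

/-! The embedding uses only problems `ofDom A`, whose single solution is the zero sequence. For them
the backward functional is trivial: `ofDom A` reduces to `ofDom B` iff some oracle program maps
every point of `A` to a point of `B`, which is Medvedev reducibility of `B` to `A`.

By the prime ideal theorem, a countable distributive lattice is represented by sets `P a` of natural
numbers, with joins and meets becoming unions and intersections, and with `0` put into every set.
Send `a` to `ofDom (A a)`, where `A a` consists of the instances with labels in `P a`. An instance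
with label `k` reveals `k`, a fixed parameter `z` that codes all the sets `P a`, and every column of
a point `x` except column `k - 1`; label `0` hides nothing.

Monotonicity is inclusion of domains, so three facts remain. Joins: from `k` and `z` one decides
whether `k ∈ P a`, hence on which side of `boxplus` an instance belongs (`exists_tag_of_param`).
Meets: equal labels lie in both sets; two instances with different labels hide different columns, so
together they give all of `x`, which is the instance with label `0` (`exists_merge`). Order
reflection, and with it injectivity: if `i + 1 ∈ P a \ P b`, a reduction would turn the instance
that hides column `i` into one that shows it (`exists_column`). A point `x` for which no column is
computable from the instance hiding it exists by the Baire category theorem (`exists_generic`), as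
there are countably many oracle programs and a halting computation depends on an open condition on
the oracle. -/

/-! ## Countability and continuity of the partial recursive functionals -/

/-- Codes of oracle programs. -/
inductive OracleCode : Type
  | zero : OracleCode
  | succ : OracleCode
  | left : OracleCode
  | right : OracleCode
  | oracle : OracleCode
  | pair : OracleCode → OracleCode → OracleCode
  | comp : OracleCode → OracleCode → OracleCode
  | prec : OracleCode → OracleCode → OracleCode
  | rfind : OracleCode → OracleCode

/-- An injective numbering of oracle programs. -/
def OracleCode.toNat : OracleCode → ℕ
  | zero => 0
  | succ => 1
  | left => 2
  | right => 3
  | oracle => 4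
  | pair c d => 4 * Nat.pair c.toNat d.toNat + 5
  | comp c d => 4 * Nat.pair c.toNat d.toNat + 6
  | prec c d => 4 * Nat.pair c.toNat d.toNat + 7
  | rfind c => 4 * c.toNat + 8

/-- The atomic codes receive the numbers up to `4`; the compound ones receive larger numbers whose
residue modulo `4` identifies the constructor. So `omega` refutes all clashes between different
constructors. -/
theorem OracleCode.toNat_injective : Function.Injective OracleCode.toNat := by
  have pair_inj : ∀ {c d c' d' : OracleCode}, (∀ b, c.toNat = b.toNat → c = b) →
      (∀ b, d.toNat = b.toNat → d = b) →
      Nat.pair c.toNat d.toNat = Nat.pair c'.toNat d'.toNat → c = c' ∧ d = d' :=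
    fun hc hd h => (Nat.pair_eq_pair.1 h).imp (hc _) (hd _)
  have cancel : ∀ {k m n : ℕ}, 4 * m + k = 4 * n + k → m = n := by omega
  intro a
  induction a with
  | pair c d hc hd | comp c d hc hd | prec c d hc hd =>
    intro b h
    cases b <;> simp only [toNat] at h <;> try omega
    obtain ⟨rfl, rfl⟩ := pair_inj hc hd (cancel h)
    rfl
  | rfind c hc =>
    intro b h
    cases b <;> simp only [toNat] at h <;> try omega
    rw [hc (cancel h)]
  | _ =>
    intro b h
    cases b <;> simp only [toNat] at h <;> first | rfl | omega

instance : Countable OracleCode := OracleCode.toNat_injective.countable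

/-- The functional that is computed by an oracle program. -/
def OracleCode.eval : OracleCode → Cantor → ℕ →. ℕ
  | zero => fun _ _ => Part.some 0
  | succ => fun _ n => Part.some (n + 1)
  | left => fun _ n => Part.some (Nat.unpair n).1
  | right => fun _ n => Part.some (Nat.unpair n).2
  | oracle => fun p n => Part.some (p n).toNat
  | pair c d => fun p n => (c.eval p n).bind fun a => (d.eval p n).map fun b => Nat.pair a b
  | comp c d => fun p n => (d.eval p n).bind fun a => c.eval p a
  | prec c d => fun p m =>
      Nat.rec (c.eval p (Nat.unpair m).1)
        (fun y IH => IH.bind fun i => d.eval p (Nat.pair (Nat.unpair m).1 (Nat.pair y i)))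
        (Nat.unpair m).2
  | rfind c => fun p a =>
      Nat.rfind fun n => (c.eval p (Nat.pair a n)).map fun m => decide (m = 0)

/-- The clauses of `OracleCode.eval` copy those of `OracleRec`. Passing to codes gives data that can
be numbered, which a derivation of a proposition cannot. -/
theorem OracleRec.exists_code {T : Cantor → ℕ →. ℕ} (hT : OracleRec T) :
    ∃ c : OracleCode, c.eval = T := by
  induction hT with
  | zero => exact ⟨.zero, rfl⟩
  | succ => exact ⟨.succ, rfl⟩
  | left => exact ⟨.left, rfl⟩
  | right => exact ⟨.right, rfl⟩
  | oracle => exact ⟨.oracle, rfl⟩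
  | pair _ _ h1 h2 =>
    obtain ⟨c, rfl⟩ := h1
    obtain ⟨d, rfl⟩ := h2
    exact ⟨.pair c d, rfl⟩
  | comp _ _ h1 h2 =>
    obtain ⟨c, rfl⟩ := h1
    obtain ⟨d, rfl⟩ := h2
    exact ⟨.comp c d, rfl⟩
  | prec _ _ h1 h2 =>
    obtain ⟨c, rfl⟩ := h1
    obtain ⟨d, rfl⟩ := h2
    exact ⟨.prec c d, rfl⟩
  | rfind _ h =>
    obtain ⟨c, rfl⟩ := h
    exact ⟨.rfind c, rfl⟩

theorem countable_setOf_oracleRec : {T | OracleRec T}.Countable :=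
  (Set.countable_range OracleCode.eval).mono fun _ hT => OracleRec.exists_code hT

/-- A composite computation halts through some intermediate value `a`, so the set is a union over
`a` of open sets. -/
theorem isOpen_setOf_mem_bind {f : Cantor → Part ℕ} {g : Cantor → ℕ → Part ℕ}
    (hf : ∀ a, IsOpen {p | a ∈ f p}) (hg : ∀ a v, IsOpen {p | v ∈ g p a}) (v : ℕ) :
    IsOpen {p | v ∈ (f p).bind (g p)} := by
  have e : {p | v ∈ (f p).bind (g p)} = ⋃ a, {p | a ∈ f p} ∩ {p | v ∈ g p a} := by
    ext p
    simp [Part.mem_bind_iff]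
  rw [e]
  exact isOpen_iUnion fun a => (hf a).inter (hg a v)

theorem isOpen_setOf_mem_map {α : Type*} {f : Cantor → Part ℕ} (h : ℕ → α)
    (hf : ∀ a, IsOpen {p | a ∈ f p}) (v : α) : IsOpen {p | v ∈ (f p).map h} := by
  have e : {p | v ∈ (f p).map h} = ⋃ a, ⋃ _ : h a = v, {p | a ∈ f p} := by
    ext p
    simp [Part.mem_map_iff, and_comm]
  rw [e]
  exact isOpen_iUnion fun a => isOpen_iUnion fun _ => hf a

/-- A halting computation depends on finitely many values of the oracle only. -/
theorem OracleRec.isOpen {T : Cantor → ℕ →. ℕ} (hT : OracleRec T) (n v : ℕ) :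
    IsOpen {p | v ∈ T p n} := by
  induction hT generalizing n v with
  | zero => exact isOpen_const
  | succ => exact isOpen_const
  | left => exact isOpen_const
  | right => exact isOpen_const
  | oracle =>
    have hc : Continuous fun p : Cantor => p n := continuous_apply n
    simp only [Part.mem_some_iff]
    exact (isOpen_discrete {b : Bool | v = b.toNat}).preimage hc
  | pair _ _ h1 h2 =>
    exact isOpen_setOf_mem_bind (h1 n) (fun a => isOpen_setOf_mem_map _ (h2 n)) v
  | comp _ _ h1 h2 => exact isOpen_setOf_mem_bind (h2 n) h1 v
  | prec _ _ h1 h2 =>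
    beta_reduce
    -- Freeing the recursion counter from the pairing allows induction on it; each round is a
    -- further `bind`.
    generalize (Nat.unpair n).1 = a
    generalize (Nat.unpair n).2 = k
    induction k generalizing v with
    | zero => exact h1 a v
    | succ k ih => exact isOpen_setOf_mem_bind ih (fun i => h2 _) v
  | @rfind f _ h =>
    -- That `v` is the least zero involves only the computations at arguments up to `v`, so a finite
    -- intersection of open sets suffices.
    have e : {p | v ∈ Nat.rfind fun k => (f p (Nat.pair n k)).map fun m => decide (m = 0)} =
        {p | true ∈ (f p (Nat.pair n v)).map fun m => decide (m = 0)} ∩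
          ⋂ k ∈ Finset.range v, {p | false ∈ (f p (Nat.pair n k)).map fun m => decide (m = 0)} := by
      ext p
      simp only [Set.mem_ofPred_eq, Set.mem_inter_iff, Set.mem_iInter, Finset.mem_range]
      exact mem_rfind_iff
    rw [e]
    exact (isOpen_setOf_mem_map _ (h _) _).inter
      (isOpen_biInter_finset fun k _ => isOpen_setOf_mem_map _ (h _) _)

/-! ## Generic points -/

/-- The points whose column `i` is computed from an oracle that does not depend on this column
form a nowhere dense set. -/
theorem OracleRec.isNowhereDense {T : Cantor → ℕ →. ℕ} (hT : OracleRec T) {i : ℕ}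
    {w : Cantor → Cantor} (hw : Continuous w)
    (hi : ∀ x n b, w (Function.update x (Nat.pair i n) b) = w x) :
    IsNowhereDense {x | Computes T (w x) fun n => x (Nat.pair i n)} := by
  rw [isNowhereDense_iff_forall_notMem_nhds]
  intro x hx hU
  -- `y n` flips bit `n` of column `i`. The flipped position moves to infinity, so `y n` tends to
  -- `x` and some `y n` lies in the closure; yet `w (y n) = w x`, so the program still outputs the
  -- old bit.
  let y : ℕ → Cantor := fun n => Function.update x (Nat.pair i n) (!x (Nat.pair i n))
  have hy : Filter.Tendsto y Filter.atTop (nhds x) := by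
    rw [tendsto_pi_nhds]
    intro m
    refine tendsto_const_nhds.congr' ?_
    filter_upwards [Filter.eventually_gt_atTop m] with n hn
    have : m ≠ Nat.pair i n := by
      have := Nat.right_le_pair i n
      omega
    simp [y, this]
  obtain ⟨n, hn⟩ := (hy.eventually hU).exists
  have hc : Continuous fun z : Cantor => z (Nat.pair i n) := continuous_apply _
  have hyn : (x (Nat.pair i n)).toNat ∈ T (w (y n)) n := by
    simp only [y, hi]
    exact hx n
  -- Near `y n` both the old output at `n` and the flipped bit persist. A point `z` of the set in
  -- this neighbourhood would have to satisfy both.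
  obtain ⟨z, ⟨hz1, hz2⟩, hz⟩ := mem_closure_iff.1 hn
    ({z | (x (Nat.pair i n)).toNat ∈ T (w z) n} ∩ {z | z (Nat.pair i n) = !x (Nat.pair i n)})
    (((hT.isOpen n _).preimage hw).inter
      ((isOpen_discrete {!x (Nat.pair i n)}).preimage hc)) ⟨hyn, by simp [y]⟩
  have h : (x (Nat.pair i n)).toNat = (z (Nat.pair i n)).toNat := Part.mem_unique hz1 (hz n)
  rw [show z (Nat.pair i n) = !x (Nat.pair i n) from hz2] at h
  revert h
  cases x (Nat.pair i n) <;> simp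

/-- For each of the countably many pairs of a program and a column the bad points are nowhere dense.
Cantor space is not meagre in itself, so one `x` avoids them all. -/
theorem exists_generic {w : ℕ → Cantor → Cantor} (hw : ∀ i, Continuous (w i))
    (hi : ∀ i x n b, w i (Function.update x (Nat.pair i n) b) = w i x) :
    ∃ x : Cantor, ∀ T, OracleRec T → ∀ i, ¬ Computes T (w i x) fun n => x (Nat.pair i n) := by
  have hm : IsMeagre (⋃ T ∈ {T | OracleRec T}, ⋃ i,
      {x | Computes T (w i x) fun n => x (Nat.pair i n)}) :=
    isMeagre_biUnion countable_setOf_oracleRec fun T hT =>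
      isMeagre_iUnion fun i => (OracleRec.isNowhereDense hT (hw i) (hi i)).isMeagre
  have hne : (⋃ T ∈ {T | OracleRec T}, ⋃ i,
      {x | Computes T (w i x) fun n => x (Nat.pair i n)}) ≠ Set.univ := fun h =>
    not_isMeagre_of_isOpen isOpen_univ Set.univ_nonempty (h ▸ hm)
  obtain ⟨x, hx⟩ := (Set.ne_univ_iff_exists_notMem _).1 hne
  refine ⟨x, fun T hT i h => hx ?_⟩
  simp only [Set.mem_iUnion]
  exact ⟨T, hT, i, h⟩

/-! ## Representation of countable distributive lattices -/

/-- If `a ≤ b` fails, the filter above `a` and the ideal below `b` are disjoint, and the prime ideal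
theorem separates them. -/
theorem exists_isPrime_of_not_le {L : Type*} [DistribLattice L] {a b : L} (h : ¬ a ≤ b) :
    ∃ J : Order.Ideal L, J.IsPrime ∧ a ∉ J ∧ b ∈ J := by
  have hd : Disjoint (Order.PFilter.principal a : Set L) (Order.Ideal.principal b : Set L) := by
    rw [Set.disjoint_left]
    intro x hx hx'
    exact h (le_trans (Order.PFilter.mem_principal.1 hx) (Order.Ideal.mem_principal.1 hx'))
  obtain ⟨J, hJ, hb, ha⟩ := DistribLattice.prime_ideal_of_disjoint_filter_ideal hd
  exact ⟨J, hJ, Set.disjoint_left.1 ha (Order.PFilter.mem_principal.2 le_rfl),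
    hb (Order.Ideal.mem_principal.2 le_rfl)⟩

/-- A countable distributive lattice is isomorphic to a lattice of sets of natural numbers that
contain zero. -/
theorem exists_set_representation (L : Type*) [DistribLattice L] [Countable L] :
    ∃ P : L → Set ℕ, (∀ a, 0 ∈ P a) ∧ (∀ a b, P (a ⊔ b) = P a ∪ P b) ∧
      (∀ a b, P (a ⊓ b) = P a ∩ P b) ∧ ∀ a b, P a ⊆ P b → a ≤ b := by
  -- One separating prime ideal for each failure of `≤`; these are countably many, and they already
  -- suffice to recover the order.
  choose J hJ haJ hbJ using fun j : {x : L × L // ¬ x.1 ≤ x.2} => exists_isPrime_of_not_le j.2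
  obtain ⟨e, he⟩ := exists_injective_nat {x : L × L // ¬ x.1 ≤ x.2}
  -- This is where primeness enters; the dual statement for joins holds for every ideal.
  have hinf : ∀ j a b, a ⊓ b ∉ J j ↔ a ∉ J j ∧ b ∉ J j := fun j a b => by
    rw [← not_or, not_iff_not]
    exact ⟨(hJ j).mem_or_mem, fun h => h.elim (fun h => (J j).lower inf_le_left h)
      fun h => (J j).lower inf_le_right h⟩
  have hsup : ∀ j a b, a ⊔ b ∉ J j ↔ a ∉ J j ∨ b ∉ J j := fun j a b => by
    rw [← not_and_or, not_iff_not, Order.Ideal.sup_mem_iff]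
  -- An element is represented by the primes that omit it. The shift by one reserves `0` as a common
  -- element of all the sets.
  refine ⟨fun a => {k | k = 0 ∨ ∃ j, k = e j + 1 ∧ a ∉ J j}, fun a => Or.inl rfl, ?_, ?_, ?_⟩
  · intro a b
    ext k
    simp only [hsup, Set.mem_ofPred_eq, Set.mem_union]
    grind
  · intro a b
    ext k
    simp only [hinf, Set.mem_ofPred_eq, Set.mem_inter_iff]
    constructor
    · grind
    · rintro ⟨rfl | ⟨j, rfl, hj⟩, h⟩
      · exact Or.inl rfl
      · rcases h with h | ⟨j', h, hj'⟩
        · omega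
        · obtain rfl : j = j' := he (by omega)
          exact Or.inr ⟨j, rfl, hj, hj'⟩
  · intro a b h
    by_contra hab
    rcases h (Or.inr ⟨⟨(a, b), hab⟩, rfl, haJ ⟨(a, b), hab⟩⟩) with h | ⟨j, h, hj⟩
    · omega
    · obtain rfl := he (show e ⟨(a, b), hab⟩ = e j by omega)
      exact hj (hbJ ⟨(a, b), hab⟩)

/-! ## Problems with a computable solution -/

/-- Search for the unique number with a decidable property. -/
theorem exists_search {c F : Cantor → ℕ → ℕ} (hc : TotalRec c) (hF : TotalRec F) :
    ∃ T, OracleRec T ∧ ∀ p k, (∀ j, c p j ≠ 0 ↔ j = k) →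
      ∀ n, F p (Nat.pair n k) ∈ T p n := by
  -- Stage `j` tests the candidate `j`; the successor separates a found value from the `0` of an
  -- unsuccessful stage.
  obtain ⟨T, hT, h⟩ := OracleRec.of_stage_unique
    ((hc.comp TotalRec.id.snd).ite (TotalRec.const 0) hF.succ)
  refine ⟨T, hT, fun p k hk n => ?_⟩
  simp only [Nat.unpair_pair] at h
  have key : ∀ j v, (if c p j = 0 then 0 else F p (Nat.pair n j) + 1) = v + 1 → j = k := by
    intro j v hj
    split_ifs at hj with h0
    exact (hk j).1 h0
  refine (h p n (fun v w j l hv hw => ?_) _).2 ⟨k, if_neg ((hk k).2 rfl)⟩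
  obtain rfl := key j v hv
  obtain rfl := key l w hw
  omega

namespace Problem

/-- The problem with domain `A` and the zero sequence as its only solution. -/
def ofDom (A : Set Cantor) : Problem where
  sol p := {q | p ∈ A ∧ q = fun _ => false}

theorem mem_dom_ofDom {A : Set Cantor} {p : Cantor} : p ∈ (ofDom A).dom ↔ p ∈ A :=
  ⟨fun ⟨_, h, _⟩ => h, fun h => ⟨_, h, rfl⟩⟩

theorem exists_computes_zero : ∃ T, OracleRec T ∧ ∀ p, Computes T p fun _ => false :=
  ⟨_, TotalRec.const 0, fun _ => TotalRec.computes fun _ => rfl⟩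

/-- The backward functional ignores its input and returns the zero sequence, so only the forward
program matters. -/
theorem ofDom_le {A : Set Cantor} {g : Problem} {S : Cantor → ℕ →. ℕ} (hS : OracleRec S)
    (h : ∀ p ∈ A, ∃ p' ∈ g.dom, Computes S p p') : ofDom A ≤ g := by
  obtain ⟨T, hT, hT0⟩ := exists_computes_zero
  refine sWReducible_iff.2 ⟨S, T, hS, hT, fun p hp => ?_⟩
  have hp := mem_dom_ofDom.1 hp
  obtain ⟨p', hp', hSp⟩ := h p hp
  exact ⟨p', hp', hSp, fun q _ => ⟨_, ⟨hp, rfl⟩, hT0 q⟩⟩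

theorem ofDom_mono {A B : Set Cantor} (h : A ⊆ B) : ofDom A ≤ ofDom B := by
  obtain ⟨S, hS, hS1⟩ := exists_id
  exact ofDom_le hS fun p hp => ⟨p, mem_dom_ofDom.2 (h hp), hS1 p⟩

/-- The converse of `ofDom_le` for problems of this form: what is left of a reduction is its forward
program. -/
theorem exists_computes_of_ofDom_le {A B : Set Cantor} (h : ofDom A ≤ ofDom B) :
    ∃ S, OracleRec S ∧ ∀ p ∈ A, ∃ p' ∈ B, Computes S p p' := by
  obtain ⟨S, T, hS, -, h1⟩ := sWReducible_iff.1 h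
  refine ⟨S, hS, fun p hp => ?_⟩
  obtain ⟨p', hp', hSp, -⟩ := h1 p (mem_dom_ofDom.2 hp)
  exact ⟨p', mem_dom_ofDom.1 hp', hSp⟩

/-- Either component may be solved, and the zero sequence solves the left one. So the backward
functional can always prefix the tag `0`. -/
theorem meet_ofDom_le {A B C : Set Cantor} {S : Cantor → ℕ →. ℕ} (hS : OracleRec S)
    (h : ∀ p ∈ A, ∀ q ∈ B, ∃ r ∈ C, Computes S (cjoin p q) r) :
    meet (ofDom A) (ofDom B) ≤ ofDom C := by
  obtain ⟨T, hT, hT0⟩ := exists_addTag 0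
  refine sWReducible_iff.2 ⟨S, T, hS, hT, fun p hp => ?_⟩
  obtain ⟨p₀, h0, p₁, h1, rfl⟩ := meet_dom hp
  have hA := mem_dom_ofDom.1 h0
  obtain ⟨r, hr, hSr⟩ := h p₀ hA p₁ (mem_dom_ofDom.1 h1)
  refine ⟨r, mem_dom_ofDom.2 hr, hSr, ?_⟩
  rintro q ⟨-, rfl⟩
  exact ⟨_, ⟨p₀, h0, p₁, h1, rfl, Or.inl ⟨_, ⟨hA, rfl⟩, rfl⟩⟩, hT0 _⟩

/-- A solution must be named by an approximation `a`; the other component is arbitrary, and `a` is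
reused there. -/
theorem tag_mem_dom_boxplus_left {f : Problem} (g : Problem) {p : Cantor} (hp : p ∈ f.dom) :
    cjoin (tag 0) p ∈ (boxplus f g).dom := by
  obtain ⟨y, hy⟩ := hp
  obtain ⟨a, ha⟩ := exists_mem_approxEval y
  exact ⟨cjoin a a, a, a, rfl, Or.inl ⟨p, rfl, y, ha, hy⟩⟩

theorem tag_mem_dom_boxplus_right (f : Problem) {g : Problem} {p : Cantor} (hp : p ∈ g.dom) :
    cjoin (tag 1) p ∈ (boxplus f g).dom := by
  obtain ⟨y, hy⟩ := hp
  obtain ⟨a, ha⟩ := exists_mem_approxEval y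
  exact ⟨cjoin a a, a, a, rfl, Or.inr ⟨p, rfl, y, ha, hy⟩⟩

end Problem

/-! ## Instances built from a generic point -/

/-- The point `x` with column `k - 1` erased; nothing is erased if `k = 0`. -/
def eraseColumn (x : Cantor) (k : ℕ) : Cantor := fun m =>
  if m.unpair.1 + 1 = k then false else x m

/-- The instance with label `k`: it tells `k`, the parameter `z`, and all columns of `x` but
column `k - 1`. -/
def labelledInstance (z x : Cantor) (k : ℕ) : Cantor :=
  cjoin (tag k) (cjoin z (eraseColumn x k))

theorem continuous_cjoin {f g : Cantor → Cantor} (hf : Continuous f) (hg : Continuous g) :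
    Continuous fun x => cjoin (f x) (g x) := by
  refine continuous_pi fun n => ?_
  by_cases h : n % 2 = 0
  · have hc : Continuous fun x => f x (n / 2) := (continuous_apply (n / 2)).comp hf
    simpa [cjoin, h] using hc
  · have hc : Continuous fun x => g x (n / 2) := (continuous_apply (n / 2)).comp hg
    simpa [cjoin, h] using hc

theorem continuous_labelledInstance (z : Cantor) (k : ℕ) :
    Continuous fun x => labelledInstance z x k := by
  refine continuous_cjoin continuous_const (continuous_cjoin continuous_const ?_)
  refine continuous_pi fun m => ?_
  by_cases h : m.unpair.1 + 1 = k
  · simpa [eraseColumn, h] using continuous_const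
  · simpa [eraseColumn, h] using continuous_apply m

/-- The changed bit lies in the erased column. This is the independence that `exists_generic`
requires. -/
theorem labelledInstance_update (z x : Cantor) (i n : ℕ) (b : Bool) :
    labelledInstance z (Function.update x (Nat.pair i n) b) (i + 1) =
      labelledInstance z x (i + 1) := by
  have h : eraseColumn (Function.update x (Nat.pair i n) b) (i + 1) =
      eraseColumn x (i + 1) := by
    funext m
    by_cases hm : m.unpair.1 = i
    · simp [eraseColumn, hm]
    · have : m ≠ Nat.pair i n := by
        rintro rfl
        simp at hm
      simp [eraseColumn, hm, this]
  rw [labelledInstance, h, labelledInstance]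

/-- Addresses inside nested joins are composites of `2 * n` and `2 * n + 1`. -/
theorem totalRec_affine (a b : ℕ) : TotalRec fun _ n => a * n + b :=
  TotalRec.of_computable (Primrec.nat_add.comp
    (Primrec.nat_mul.comp (Primrec.const a) Primrec.id) (Primrec.const b)).to_comp

/-- Column `i` can be computed from every instance whose label is not `i + 1`. -/
theorem exists_column (i : ℕ) : ∃ T, OracleRec T ∧ ∀ z x k, k ≠ i + 1 →
    Computes T (labelledInstance z x k) fun n => x (Nat.pair i n) := by
  refine ⟨_, TotalRec.oracle.comp ((totalRec_affine 2 1).comp ((totalRec_affine 2 1).comp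
    ((TotalRec.const i).pair TotalRec.id))), fun z x k hk => TotalRec.computes fun n => ?_⟩
  rw [labelledInstance, cjoin_two_mul_add_one, cjoin_two_mul_add_one, eraseColumn,
    if_neg (by simpa using hk.symm)]

/-- Case distinction on the parameter. -/
theorem exists_tag_of_param (c : ℕ) : ∃ T, OracleRec T ∧ ∀ z x k,
    Computes T (labelledInstance z x k)
      (cjoin (tag (if z (Nat.pair c k) = true then 0 else 1)) (labelledInstance z x k)) := by
  have hlab : TotalRec fun p n => (p (2 * n + 0)).toNat :=
    TotalRec.oracle.comp (totalRec_affine 2 0)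
  -- The first half of the second half of an instance is `z`; the second component of `m` is the
  -- label found by the search.
  have hz : TotalRec fun p m => (p (2 * (2 * Nat.pair c m.unpair.2 + 0) + 1)).toNat :=
    TotalRec.oracle.comp ((totalRec_affine 2 1).comp ((totalRec_affine 2 0).comp
      ((TotalRec.const c).pair TotalRec.id.snd)))
  have hF := TotalRec.iteEq TotalRec.id.fst
    (hz.ite (TotalRec.const 1) (TotalRec.const 0)) (TotalRec.const 1) (TotalRec.const 0)
  obtain ⟨S, hS, hS1⟩ := exists_search hlab hF
  obtain ⟨I, hI, hI1⟩ := exists_id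
  obtain ⟨R, hR, hR1⟩ := exists_cjoin hS hI
  refine ⟨R, hR, fun z x k => hR1 _ _ _ (fun n => ?_) (hI1 _)⟩
  have := hS1 (labelledInstance z x k) k (fun j => by
    rw [labelledInstance, add_zero, cjoin_two_mul]
    simp [tag]) n
  convert this using 1
  simp only [labelledInstance, cjoin_two_mul_add_one, add_zero, cjoin_two_mul, Nat.unpair_pair]
  cases z (Nat.pair c k) <;> simp [tag, Bool.toNat, Bool.cond_decide]

/-- Two instances with different labels compute the instance with label `0`. -/
theorem exists_merge : ∃ T, OracleRec T ∧ ∀ z x k l,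
    Computes T (cjoin (labelledInstance z x k) (labelledInstance z x l))
      (labelledInstance z x (if k = l then k else 0)) := by
  -- The search is for the pair of labels `⟨k, l⟩`: the two tags must hold at its components.
  have hlab : TotalRec fun p m => if (p (2 * (2 * m.unpair.1 + 0) + 0)).toNat = 0 then 0 else
      (p (2 * (2 * m.unpair.2 + 0) + 1)).toNat :=
    (TotalRec.oracle.comp ((totalRec_affine 2 0).comp
      ((totalRec_affine 2 0).comp TotalRec.id.fst))).ite (TotalRec.const 0)
      (TotalRec.oracle.comp ((totalRec_affine 2 1).comp
        ((totalRec_affine 2 0).comp TotalRec.id.snd)))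
  have hmod : TotalRec fun _ m => m.unpair.1 % 2 :=
    TotalRec.of_computable (Primrec.nat_mod.comp
      (Primrec.fst.comp Primrec.unpair) (Primrec.const 2)).to_comp
  have h0 := TotalRec.oracle.comp ((totalRec_affine 2 0).comp TotalRec.id.fst)
  have h1 := TotalRec.oracle.comp ((totalRec_affine 2 1).comp TotalRec.id.fst)
  -- For equal labels the first instance is copied. Otherwise the even bits form the tag `0`, and
  -- the odd bits are the disjunction of the two instances: both agree on `z`, and a bit of `x`
  -- erased in one survives in the other.
  have hF := TotalRec.iteEq TotalRec.id.snd.fst TotalRec.id.snd.snd h0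
    (hmod.ite (TotalRec.id.fst.ite (TotalRec.const 1) (TotalRec.const 0))
      (h0.ite h1 (TotalRec.const 1)))
  obtain ⟨S, hS, hS1⟩ := exists_search hlab hF
  refine ⟨S, hS, fun z x k l n => ?_⟩
  have := hS1 (cjoin (labelledInstance z x k) (labelledInstance z x l)) (Nat.pair k l)
    (fun j => by
      simp only [add_zero, cjoin_two_mul, cjoin_two_mul_add_one, labelledInstance]
      have hj : j = Nat.pair k l ↔ j.unpair.1 = k ∧ j.unpair.2 = l := by
        rw [← Nat.pair_eq_pair, Nat.pair_unpair]
      simp [hj, tag]) n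
  convert this using 1
  simp only [add_zero, cjoin_two_mul, cjoin_two_mul_add_one, Nat.unpair_pair]
  by_cases hkl : k = l
  · simp [hkl]
  rw [if_neg hkl, if_neg hkl]
  by_cases hn : n % 2 = 0
  · obtain ⟨m, rfl⟩ : ∃ m, n = 2 * m := ⟨n / 2, by omega⟩
    rw [if_pos hn, labelledInstance, cjoin_two_mul]
    by_cases hm : m = 0 <;> simp [tag, hm]
  · obtain ⟨m, rfl⟩ : ∃ m, n = 2 * m + 1 := ⟨n / 2, by omega⟩
    rw [if_neg hn]
    simp only [labelledInstance, cjoin_two_mul_add_one]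
    have h : ∀ a b c : Bool, a = (b || c) →
        a.toNat = if b.toNat = 0 then c.toNat else 1 := by decide
    refine h _ _ _ ?_
    by_cases hm : m % 2 = 0
    · simp [cjoin, hm]
    -- These are the bits of `x`. If the first instance erases the column, the second does not,
    -- since `k ≠ l`.
    · simp only [cjoin, hm, if_false, eraseColumn]
      by_cases hk : (m / 2).unpair.1 + 1 = k
      · have hk0 : k ≠ 0 := by omega
        simp [hk, hkl, hk0]
      · simp [hk]

/-! ### The embedding -/

theorem mainTheorem7 (L : Type*) [DistribLattice L] [Countable L] :
    ∃ φ : LatticeHom L SWDegree, Function.Injective φ := by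
  classical
  obtain ⟨P, hP0, hPsup, hPinf, hPle⟩ := exists_set_representation L
  obtain ⟨e, he⟩ := exists_injective_nat L
  -- `z` need not be computable; it is shared by all instances, so that membership of a label in `P
  -- a` becomes decidable from any of them.
  let z : Cantor := fun m => decide (∃ a, e a = m.unpair.1 ∧ m.unpair.2 ∈ P a)
  have hz : ∀ a k, z (Nat.pair (e a) k) = true ↔ k ∈ P a := fun a k => by
    simp only [z, Nat.unpair_pair, decide_eq_true_eq]
    exact ⟨fun ⟨b, hb, hk⟩ => he hb ▸ hk, fun hk => ⟨a, rfl, hk⟩⟩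
  obtain ⟨x, hx⟩ := exists_generic (w := fun i x => labelledInstance z x (i + 1))
    (fun i => continuous_labelledInstance z (i + 1)) fun i x n b =>
      labelledInstance_update z x i n b
  let A : L → Set Cantor := fun a => Set.image (labelledInstance z x) (P a)
  have hmono : ∀ a b, a ≤ b → Problem.ofDom (A a) ≤ Problem.ofDom (A b) := fun a b h =>
    Problem.ofDom_mono (Set.image_mono (by
      rw [← sup_eq_right.2 h, hPsup]
      exact Set.subset_union_left))
  -- The parameter decides whether the label lies in `P a`; if not, it lies in `P b`.
  have hsup : ∀ a b, Problem.ofDom (A (a ⊔ b)) ≤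
      Problem.boxplus (Problem.ofDom (A a)) (Problem.ofDom (A b)) := by
    intro a b
    obtain ⟨T, hT, hT1⟩ := exists_tag_of_param (e a)
    refine Problem.ofDom_le hT ?_
    rintro _ ⟨k, hk, rfl⟩
    refine ⟨_, ?_, hT1 z x k⟩
    by_cases hka : k ∈ P a
    · rw [if_pos ((hz a k).2 hka)]
      exact Problem.tag_mem_dom_boxplus_left _ (Problem.mem_dom_ofDom.2 ⟨k, hka, rfl⟩)
    · rw [if_neg (mt (hz a k).1 hka)]
      have hkb : k ∈ P b := by
        rw [hPsup] at hk
        exact hk.resolve_left hka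
      exact Problem.tag_mem_dom_boxplus_right _ (Problem.mem_dom_ofDom.2 ⟨k, hkb, rfl⟩)
  have hinf : ∀ a b, Problem.meet (Problem.ofDom (A a)) (Problem.ofDom (A b)) ≤
      Problem.ofDom (A (a ⊓ b)) := by
    intro a b
    obtain ⟨T, hT, hT1⟩ := exists_merge
    refine Problem.meet_ofDom_le hT ?_
    rintro _ ⟨k, hk, rfl⟩ _ ⟨l, hl, rfl⟩
    refine ⟨_, ⟨_, ?_, rfl⟩, hT1 z x k l⟩
    split_ifs with h
    · subst h
      rw [hPinf]
      exact ⟨hk, hl⟩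
    -- Different labels merge to label `0`, which is why `0` was put into every set.
    · exact hP0 _
  have hle : ∀ a b, Problem.ofDom (A a) ≤ Problem.ofDom (A b) → a ≤ b := by
    intro a b h
    obtain ⟨S, hS, hS1⟩ := Problem.exists_computes_of_ofDom_le h
    refine hPle a b fun k hk => ?_
    by_contra hkb
    -- The label is positive because `0 ∈ P b`, so its instance really hides a column.
    obtain ⟨i, rfl⟩ : ∃ i, k = i + 1 :=
      Nat.exists_eq_succ_of_ne_zero fun h0 => hkb (h0 ▸ hP0 b)
    obtain ⟨_, ⟨l, hl, rfl⟩, hSl⟩ := hS1 _ ⟨i + 1, hk, rfl⟩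
    obtain ⟨T, hT, hT1⟩ := exists_column i
    obtain ⟨R, hR, hR1⟩ := hT.exists_comp hS
    -- The target label lies in `P b` and hence differs from `i + 1`. Its instance shows column `i`,
    -- so the instance hiding this column computes it, against the choice of `x`.
    exact hx R hR i (hR1 _ _ _ hSl (hT1 z x l fun h => hkb (h ▸ hl)))
  refine ⟨⟨⟨fun a => toAntisymmetrization (· ≤ ·) (Problem.ofDom (A a)), fun a b => ?_⟩,
    fun a b => ?_⟩, fun a b h => ?_⟩
  · exact le_antisymm (hsup a b) (sup_le (hmono _ _ le_sup_left) (hmono _ _ le_sup_right))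
  · exact le_antisymm (le_inf (hmono _ _ inf_le_left) (hmono _ _ inf_le_right)) (hinf a b)
  · have h : toAntisymmetrization (· ≤ ·) (Problem.ofDom (A a)) =
        (toAntisymmetrization (· ≤ ·) (Problem.ofDom (A b)) : SWDegree) := h
    exact le_antisymm (hle a b h.le) (hle b a h.ge)
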